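/- Let $R$ be a commutative Noetherian ring, $\mathfrak a$ an ideal of $R$, $M$ a finitely generated $R$-module and $r \ge 0$ an integer. Write $H^i_{\mathfrak a}(M) = \varinjlim_n \operatorname{Ext}^i_R(R/\mathfrak a^n, M)$ for the local cohomology modules. An $R$-module $L$ is said to be in dimension $< n$ if it has a finitely generated submodule $L'$ with $\dim \operatorname{Supp}(L/L') < n$, and it is called minimax if it has a finitely generated submodule $L'$ such that $L/L'$ is Artinian. Suppose that there is an integer $t \ge 0$ such that $\mathfrak a^t H^i_{\mathfrak a}(M)$ is in dimension $< 2$ for all $i < r$. Then, for every minimax submodule $N$ of $H^r_{\mathfrak a}(M)$, the $R$-module $\operatorname{Hom}_R(R/\mathfrak a, H^r_{\mathfrak a}(M)/N)$ is finitely generated. In particular, the set $\operatorname{Ass}_R(H^r_{\mathfrak a}(M)/N)$ is finite. -/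

import Mathlib

universe u v

/-- The `i`-th local cohomology module `H^i_a(M) = colim_n Ext^i_R(R/a^n, M)`. -/
noncomputable abbrev localCohomologyModule {R : Type u} [CommRing R] (a : Ideal R) (i : ℕ)
    (M : Type u) [AddCommGroup M] [Module R M] : ModuleCat.{u} R :=
  (localCohomology a i).obj (ModuleCat.of R M)

/-- `M` is in dimension `< n`: some finitely generated submodule `N` satisfies
`dim Supp (M/N) < n` (the dimension of the empty set is `⊥`). -/
def Module.IsInDimensionLT (R : Type u) [CommRing R] (M : Type v) [AddCommGroup M] [Module R M]
    (n : ℕ) : Prop :=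
  ∃ N : Submodule R M, N.FG ∧ Module.supportDim R (M ⧸ N) < (n : WithBot ℕ∞)

/-- `L` is minimax: some finitely generated submodule `N` has Artinian quotient `L/N`. -/
def Module.IsMinimax (R : Type u) [CommRing R] (L : Type v) [AddCommGroup L] [Module R L] : Prop :=
  ∃ N : Submodule R L, N.FG ∧ IsArtinian R (L ⧸ N)

/-!
An `a`-torsion module `T` is cofinite if all the modules `Ext^j(R/a, T)` are finitely generated.
The key fact is that, for `d ≤ 2`, an `a`-torsion module `T` in dimension `< d` is cofinite as
soon as `Ext^j(R/a, T)` is finitely generated for `j < d`. For `dim Supp T < d` this goes by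
induction on `d` and Noetherian induction on the annihilator of `T`. Choose `x ∈ a` no power of
which kills `T`. The localizations of `T` at the finitely many minimal primes of its support are
Artinian, so for large `n` the modules `x^n T` and `x^(n+1) T` agree there. Hence `x^n T /
x^(n+1) T` has smaller dimension, while the kernels of `x^n` on `T` and of `x` on `x^n T` have
larger annihilators; as `x` kills `Ext^j(R/a, -)`, finiteness for these three modules gives
finiteness for `T`.

The local cohomology modules are treated by dimension shifting. If `r > 0`, then `Γ_a(M) ≅
H^0_a(M)` is cofinite, `M / Γ_a(M)` embeds into an injective module `E` with `Γ_a(E) = 0`, and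
`H^(i+1)_a(M) ≅ H^i_a(C)` for the cokernel `C` of this embedding. By induction on `r` the modules
`Hom(R/a, H^r_a(M))` and `Ext^1(R/a, H^r_a(M))` are finitely generated. A minimax submodule `N`
of `H^r_a(M)` is in dimension `< 1`, hence cofinite, and `Hom(R/a, H^r_a(M) / N)` lies between
`Hom(R/a, H^r_a(M))` and `Ext^1(R/a, N)`.
-/

section ExtComparison

open CategoryTheory Limits Opposite

variable {R : Type u} [CommRing R] {X X' : ModuleCat.{u} R}

lemma extMk_zero_eq_zero_iff (P : ProjectiveResolution X) {Y : ModuleCat.{u} R} (m : ℕ)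
    (hm : 0 + 1 = m) (f : P.complex.X 0 ⟶ Y) (hf : P.complex.d m 0 ≫ f = 0) :
    P.extMk f m hm hf = 0 ↔ f = 0 := by
  refine ⟨fun h ↦ ?_, by rintro rfl; simp⟩
  rw [← P.extEquivCohomologyClass.apply_eq_iff_eq,
    ProjectiveResolution.extEquivCohomologyClass_extMk,
    ProjectiveResolution.extEquivCohomologyClass_zero,
    CochainComplex.HomComplex.CohomologyClass.mk_eq_zero_iff,
    CochainComplex.HomComplex.Cocycle.toSingleMk_mem_coboundaries_iff _ _ _ _ _ 1 (by simp)] at h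
  obtain ⟨g, hg⟩ := h
  have hg_zero : g = 0 :=
    (CochainComplex.isZero_of_isStrictlyLE P.cochainComplex 0 1).eq_of_src _ _
  rw [hg_zero, comp_zero] at hg
  rw [← cancel_epi (P.cochainComplexXIso (-(0 : ℕ)) 0 rfl).hom, ← hg, comp_zero]

lemma extMk_eq_zero_iff_exists_prev (P : ProjectiveResolution X) {Y : ModuleCat.{u} R} {n : ℕ}
    (m : ℕ) (hm : n + 1 = m) (f : P.complex.X n ⟶ Y) (hf : P.complex.d m n ≫ f = 0) :
    P.extMk f m hm hf = 0 ↔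
      ∃ g : P.complex.X ((ComplexShape.up ℕ).prev n) ⟶ Y, P.complex.d n _ ≫ g = f := by
  cases n with
  | zero =>
    rw [extMk_zero_eq_zero_iff]
    refine ⟨by rintro rfl; exact ⟨0, comp_zero⟩, ?_⟩
    rintro ⟨g, rfl⟩
    rw [P.complex.shape _ _ (by simp), zero_comp]
  | succ n =>
    rw [CochainComplex.prev_nat_succ]
    exact P.extMk_eq_zero_iff _ _ _ _ n rfl

/-- The three terms `Hom(P_{n-1}, Y) ⟶ Hom(P_n, Y) ⟶ Hom(P_{n+1}, Y)` around degree `n` of the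
complex `Hom(P, Y)`, whose homology computes `Ext^n`. -/
noncomputable abbrev homComplexSc (P : ProjectiveResolution X) (Y : ModuleCat.{u} R) (n : ℕ) :
    ShortComplex (ModuleCat.{u} R) :=
  (P.complex.linearYonedaObj R Y).sc n

/-- The class in `Ext^n(X, Y)` of an `n`-cocycle of `Hom(P, Y)`, for a projective resolution `P`
of `X`. -/
noncomputable def cocycleExtClass (P : ProjectiveResolution X) (Y : ModuleCat.{u} R) (n : ℕ) :
    LinearMap.ker (homComplexSc P Y n).g.hom →ₗ[R] Abelian.Ext X Y n where
  toFun z := P.extMk z.1 ((ComplexShape.up ℕ).next n) (by simp) z.2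
  map_add' x y := (P.add_extMk _ _ _ _ _ _).symm
  map_smul' r x := by
    rw [Abelian.Ext.smul_eq_comp_mk₀]
    refine .trans ?_ (P.extMk_comp_mk₀ x.1 _ (by simp) x.2 (r • 𝟙 Y)).symm
    congr 1

lemma cocycleExtClass_surjective (P : ProjectiveResolution X) (Y : ModuleCat.{u} R) (n : ℕ) :
    Function.Surjective (cocycleExtClass P Y n) := fun α ↦ by
  obtain ⟨f, hf, h⟩ := P.extMk_surjective α ((ComplexShape.up ℕ).next n) (by simp)
  exact ⟨⟨f, hf⟩, h⟩

lemma cocycleExtClass_eq_zero_iff (P : ProjectiveResolution X) (Y : ModuleCat.{u} R) (n : ℕ)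
    (z : LinearMap.ker (homComplexSc P Y n).g.hom) :
    cocycleExtClass P Y n z = 0 ↔ ∃ g, (homComplexSc P Y n).moduleCatToCycles g = z :=
  (extMk_eq_zero_iff_exists_prev P _ (by simp) z.1 z.2).trans (exists_congr fun _ ↦
    (Subtype.ext_iff (a1 := (homComplexSc P Y n).moduleCatToCycles _)).symm)

/-- `Ext^n(X, Y)` as the homology of `Hom(P, Y)` in degree `n`. -/
noncomputable def extLeftHomologyData (P : ProjectiveResolution X) (Y : ModuleCat.{u} R) (n : ℕ) :
    (homComplexSc P Y n).LeftHomologyData :=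
  let S := homComplexSc P Y n
  let T := ShortComplex.mk (ModuleCat.ofHom S.moduleCatToCycles)
    (ModuleCat.ofHom (cocycleExtClass P Y n))
    (by ext g; exact (cocycleExtClass_eq_zero_iff P Y n _).2 ⟨g, rfl⟩)
  have hT : T.Exact := T.moduleCat_exact_iff.2 fun z ↦ (cocycleExtClass_eq_zero_iff P Y n z).1
  have : Epi T.g := (ModuleCat.epi_iff_surjective _).2 (cocycleExtClass_surjective P Y n)
  { K := S.moduleCatLeftHomologyData.K
    H := ModuleCat.of R (Abelian.Ext X Y n)
    i := S.moduleCatLeftHomologyData.i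
    π := T.g
    wi := S.moduleCatLeftHomologyData.wi
    hi := S.moduleCatLeftHomologyData.hi
    wπ := T.zero
    hπ := hT.gIsCokernel }

/-- The morphism of complexes `Hom(P', Y) ⟶ Hom(P, Y)` induced by a morphism `P ⟶ P'`. -/
noncomputable def homComplexMap {P : ProjectiveResolution X} {P' : ProjectiveResolution X'}
    (φ : P.complex ⟶ P'.complex) (Y : ModuleCat.{u} R) :
    P'.complex.linearYonedaObj R Y ⟶ P.complex.linearYonedaObj R Y :=
  (HomologicalComplex.unopFunctor _ _).map
    (((((linearYoneda R _).obj Y).rightOp.mapHomologicalComplex _).map φ).op)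

/-- Functoriality of `extLeftHomologyData` in the resolved module. -/
noncomputable def extLeftHomologyMapData {P : ProjectiveResolution X}
    {P' : ProjectiveResolution X'} {f : X ⟶ X'} (φ : ProjectiveResolution.Hom P P' f)
    (Y : ModuleCat.{u} R) (n : ℕ) :
    ShortComplex.LeftHomologyMapData
      ((HomologicalComplex.shortComplexFunctor _ _ n).map (homComplexMap φ.hom Y))
      (extLeftHomologyData P' Y n) (extLeftHomologyData P Y n) :=
  let F := (HomologicalComplex.shortComplexFunctor (ModuleCat.{u} R) _ n).map
    (homComplexMap φ.hom Y)
  let h := extLeftHomologyData P Y n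
  let h' := extLeftHomologyData P' Y n
  have hF : (h'.i ≫ F.τ₂) ≫ (homComplexSc P Y n).g = 0 := by
    rw [Category.assoc, F.comm₂₃, h'.wi_assoc, zero_comp]
  have commi : h.liftK (h'.i ≫ F.τ₂) hF ≫ h.i = h'.i ≫ F.τ₂ := h.liftK_i _ hF
  { φK := h.liftK (h'.i ≫ F.τ₂) hF
    φH := ModuleCat.ofHom ((Abelian.Ext.mk₀ f).precompOfLinear R Y (zero_add n))
    commi := commi
    commf' := by
      rw [← cancel_mono h.i, Category.assoc, commi, Category.assoc, h.f'_i, h'.f'_i_assoc,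
        F.comm₁₂]
    commπ := by
      ext z
      exact ProjectiveResolution.mk₀_comp_extMk z.1 _ (by simp) z.2 φ }

lemma isoExt_hom_naturality (P : ProjectiveResolution X) (P' : ProjectiveResolution X')
    {f : X ⟶ X'} (φ : ProjectiveResolution.Hom P P' f) (Y : ModuleCat.{u} R) (n : ℕ) :
    ((Ext R (ModuleCat.{u} R) n).map f.op).app Y ≫ (P.isoExt n Y).hom =
      (P'.isoExt n Y).hom ≫ HomologicalComplex.homologyMap (homComplexMap φ.hom Y) n := by
  have h₁ := congrArg Quiver.Hom.unop (P.isoLeftDerivedObj_inv_naturality f P' φ.hom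
    (by simpa using φ.hom_f_zero_comp_π_f_zero) ((linearYoneda R _).obj Y).rightOp n)
  have h₂ := congrArg Quiver.Hom.unop (ShortComplex.homologyOpIso_inv_naturality
    ((HomologicalComplex.shortComplexFunctor _ _ n).map (homComplexMap φ.hom Y)))
  exact CommSq.w (CommSq.vert_comp ⟨h₁⟩ ⟨h₂.symm⟩)

/-- The contravariant functor `X ↦ Ext^n(X, Y)`. -/
noncomputable def extContra (Y : ModuleCat.{u} R) (n : ℕ) :
    (ModuleCat.{u} R)ᵒᵖ ⥤ ModuleCat.{u} R where
  obj X := ModuleCat.of R (Abelian.Ext X.unop Y n)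
  map f := ModuleCat.ofHom ((Abelian.Ext.mk₀ f.unop).precompOfLinear R Y (zero_add n))
  map_id X := by
    ext e
    simp
  map_comp f g := by
    ext e
    simp

/-- The left derived functors of `Hom(-, Y)`, through which Mathlib defines local cohomology,
agree with the `Ext` groups of the derived category. -/
noncomputable def extFlipObjIso (Y : ModuleCat.{u} R) (n : ℕ) :
    (Ext R (ModuleCat.{u} R) n).flip.obj Y ≅ extContra Y n :=
  NatIso.ofComponents
    (fun X ↦ (ProjectiveResolution.of X.unop).isoExt n Y ≪≫
      (extLeftHomologyData (ProjectiveResolution.of X.unop) Y n).homologyIso)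
    fun {X X'} f ↦ by
      let φ : ProjectiveResolution.Hom (ProjectiveResolution.of X'.unop)
          (ProjectiveResolution.of X.unop) f.unop :=
        ⟨ProjectiveResolution.lift f.unop _ _, ProjectiveResolution.lift_commutes_zero _ _ _⟩
      exact CommSq.w (CommSq.vert_comp ⟨isoExt_hom_naturality _ _ φ Y n⟩
        ⟨(extLeftHomologyMapData φ Y n).homologyMap_comm⟩)

/-- The system of modules `Ext^i(R/a^n, M)`. -/
noncomputable abbrev extPowersDiagram (a : Ideal R) (i : ℕ) (M : ModuleCat.{u} R) :
    ℕᵒᵖᵒᵖ ⥤ ModuleCat.{u} R :=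
  (localCohomology.ringModIdeals (localCohomology.idealPowersDiagram a)).op ⋙ extContra M i

/-- Local cohomology as a colimit of `Ext` groups of the derived category. -/
noncomputable def localCohomologyIsoColimit (a : Ideal R) (i : ℕ) (M : ModuleCat.{u} R) :
    (localCohomology a i).obj M ≅ colimit (extPowersDiagram a i M) :=
  colimitObjIsoColimitCompEvaluation
      (localCohomology.diagram (localCohomology.idealPowersDiagram a) i) M ≪≫
    HasColimit.isoOfNatIso (Functor.isoWhiskerLeft
      (localCohomology.ringModIdeals (localCohomology.idealPowersDiagram a)).op
      (extFlipObjIso M i))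

end ExtComparison

section PowTorsion

variable {R : Type u} [CommRing R] (a : Ideal R) (M : Type v) [AddCommGroup M] [Module R M]

/-- The `a`-torsion submodule `Γ_a(M)`: the elements killed by a power of the ideal `a`. -/
def powTorsion : Submodule R M where
  carrier := {m | ∃ n : ℕ, ∀ x ∈ a ^ n, x • m = 0}
  zero_mem' := ⟨0, by simp⟩
  add_mem' := by
    rintro m m' ⟨n, h⟩ ⟨n', h'⟩
    refine ⟨n + n', fun x hx ↦ ?_⟩
    rw [smul_add, h x (Ideal.pow_le_pow_right (by simp) hx),
      h' x (Ideal.pow_le_pow_right (by simp) hx), add_zero]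
  smul_mem' := by
    rintro r m ⟨n, h⟩
    exact ⟨n, fun x hx ↦ by rw [smul_comm, h x hx, smul_zero]⟩

/-- `M` is `a`-torsion: each of its elements is killed by a power of `a`. -/
def IsPowTorsion : Prop := ∀ m : M, ∃ n : ℕ, ∀ x ∈ a ^ n, x • m = 0

variable {a M}

lemma isPowTorsion_powTorsion : IsPowTorsion a (powTorsion a M) := by
  rintro ⟨m, n, h⟩
  exact ⟨n, fun x hx ↦ Subtype.ext (h x hx)⟩

lemma IsPowTorsion.of_injective {N : Type*} [AddCommGroup N] [Module R N]
    (h : IsPowTorsion a N) (f : M →ₗ[R] N) (hf : Function.Injective f) : IsPowTorsion a M := by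
  intro m
  obtain ⟨n, hn⟩ := h (f m)
  exact ⟨n, fun x hx ↦ hf (by rw [map_smul, hn x hx, map_zero])⟩

lemma IsPowTorsion.of_surjective {N : Type*} [AddCommGroup N] [Module R N]
    (h : IsPowTorsion a M) (f : M →ₗ[R] N) (hf : Function.Surjective f) : IsPowTorsion a N := by
  intro m
  obtain ⟨m, rfl⟩ := hf m
  obtain ⟨n, hn⟩ := h m
  exact ⟨n, fun x hx ↦ by rw [← map_smul, hn x hx, map_zero]⟩

lemma IsPowTorsion.submodule (h : IsPowTorsion a M) (N : Submodule R M) : IsPowTorsion a N :=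
  h.of_injective N.subtype N.injective_subtype

lemma IsPowTorsion.quotient (h : IsPowTorsion a M) (N : Submodule R M) : IsPowTorsion a (M ⧸ N) :=
  h.of_surjective N.mkQ N.mkQ_surjective

lemma IsPowTorsion.exists_pow_smul_eq_zero [Module.Finite R M] (h : IsPowTorsion a M) :
    ∃ n : ℕ, ∀ x ∈ a ^ n, ∀ m : M, x • m = 0 := by
  suffices H : ∀ N : Submodule R M, N.FG → ∃ n : ℕ, ∀ x ∈ a ^ n, ∀ m ∈ N, x • m = 0 by
    simpa using H ⊤ Module.Finite.fg_top
  intro N hN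
  induction N, hN using Submodule.fg_induction with
  | singleton m =>
    obtain ⟨n, hn⟩ := h m
    refine ⟨n, fun x hx y hy ↦ ?_⟩
    obtain ⟨r, rfl⟩ := Submodule.mem_span_singleton.1 hy
    rw [smul_comm, hn x hx, smul_zero]
  | sup N₁ N₂ _ _ h₁ h₂ =>
    obtain ⟨n₁, hn₁⟩ := h₁
    obtain ⟨n₂, hn₂⟩ := h₂
    refine ⟨n₁ + n₂, fun x hx m hm ↦ ?_⟩
    obtain ⟨m₁, hm₁, m₂, hm₂, rfl⟩ := Submodule.mem_sup.1 hm
    rw [smul_add, hn₁ x (Ideal.pow_le_pow_right (by simp) hx) m₁ hm₁,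
      hn₂ x (Ideal.pow_le_pow_right (by simp) hx) m₂ hm₂, add_zero]

lemma powTorsion_quotient_eq_bot [IsNoetherianRing R] :
    powTorsion a (M ⧸ powTorsion a M) = ⊥ := by
  rw [eq_bot_iff]
  rintro x ⟨n, hn⟩
  obtain ⟨m, rfl⟩ := (powTorsion a M).mkQ_surjective x
  refine (Submodule.Quotient.mk_eq_zero _).2 ?_
  let N : Submodule R M := Submodule.map (LinearMap.toSpanSingleton R M m) (a ^ n)
  have : Module.Finite R N := Module.Finite.iff_fg.2 ((IsNoetherian.noetherian (a ^ n)).map _)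
  have hN : N ≤ powTorsion a M := by
    rintro _ ⟨r, hr, rfl⟩
    exact (Submodule.Quotient.mk_eq_zero _).1 (hn r hr)
  obtain ⟨k, hk⟩ := (isPowTorsion_powTorsion.of_injective (Submodule.inclusion hN)
    (Submodule.inclusion_injective hN)).exists_pow_smul_eq_zero
  refine ⟨k + n, fun y hy ↦ ?_⟩
  have hle : a ^ k * a ^ n ≤ LinearMap.ker (LinearMap.toSpanSingleton R M m) :=
    Ideal.mul_le.2 fun r hr s hs ↦ (mul_smul r s m).trans
      (congrArg Subtype.val (hk r hr ⟨s • m, s, hs, rfl⟩))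
  exact hle (pow_add a k n ▸ hy)

end PowTorsion

section InjectiveTorsion

variable {R : Type u} [CommRing R] [IsNoetherianRing R] (a : Ideal R)

variable {a} in
lemma IsPowTorsion.exists_forall_mem_pow_map_eq_zero {T : Type v} [AddCommGroup T] [Module R T]
    (hT : IsPowTorsion a T) {I : Ideal R} (g : I →ₗ[R] T) :
    ∃ m : ℕ, ∀ x : I, (x : R) ∈ a ^ m → g x = 0 := by
  obtain ⟨n, hn⟩ := (hT.submodule (LinearMap.range g)).exists_pow_smul_eq_zero
  have hker : a ^ n • (⊤ : Submodule R I) ≤ LinearMap.ker g :=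
    Submodule.smul_le.2 fun r hr z _ ↦ (map_smul g r z).trans
      (congrArg Subtype.val (hn r hr ⟨g z, z, rfl⟩))
  obtain ⟨k, hk⟩ := Ideal.exists_pow_inf_eq_pow_smul a I
  refine ⟨n + k, fun x hx ↦ hker ?_⟩
  have hx_smul : (x : R) ∈ a ^ n • (I : Submodule R R) := by
    have hx_inf : (x : R) ∈ a ^ (n + k) • (⊤ : Submodule R R) ⊓ I := ⟨by simpa using hx, x.2⟩
    rw [hk (n + k) (Nat.le_add_left _ _), Nat.add_sub_cancel] at hx_inf
    exact Submodule.smul_mono le_rfl inf_le_right hx_inf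
  have hmap : a ^ n • (I : Submodule R R) = (a ^ n • ⊤ : Submodule R I).map I.subtype := by
    rw [Submodule.map_smul'', Submodule.map_top, Submodule.range_subtype]
  obtain ⟨y, hy, hyx⟩ := hmap ▸ hx_smul
  exact Subtype.ext hyx ▸ hy

lemma injective_powTorsion (E : Type u) [AddCommGroup E] [Module R E] [Module.Injective R E] :
    Module.Injective R (powTorsion a E) := by
  refine Module.Baer.injective fun I g ↦ ?_
  obtain ⟨m, hm⟩ := isPowTorsion_powTorsion.exists_forall_mem_pow_map_eq_zero g
  let J : Submodule R I := Submodule.comap I.subtype (a ^ m)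
  have hJ : Function.Injective (J.mapQ (a ^ m) I.subtype le_rfl) := by
    rw [← LinearMap.ker_eq_bot, Submodule.ker_mapQ, Submodule.mkQ_map_self]
  obtain ⟨h, hh⟩ := Module.Injective.out (J.mapQ (a ^ m) I.subtype le_rfl) hJ
    (J.liftQ ((powTorsion a E).subtype ∘ₗ g) fun x hx ↦ congrArg Subtype.val (hm x hx))
  refine ⟨LinearMap.codRestrict _ (h ∘ₗ (a ^ m).mkQ) fun r ↦ ⟨m, fun x hx ↦ ?_⟩, fun x hx ↦ ?_⟩
  · have hxr : (a ^ m).mkQ (x • r) = 0 :=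
      (Submodule.Quotient.mk_eq_zero _).2 (Ideal.mul_mem_right r _ hx)
    rw [← map_smul, LinearMap.comp_apply, hxr, map_zero]
  · exact Subtype.ext (hh (J.mkQ ⟨x, hx⟩))

end InjectiveTorsion

section Injective

variable {R : Type u} [CommRing R]

lemma injective_quotient (E : Type u) [AddCommGroup E] [Module R E]
    [Module.Injective R E] (N : Submodule R E) [Module.Injective R N] :
    Module.Injective R (E ⧸ N) := by
  obtain ⟨ρ, hρ⟩ := Module.Injective.out N.subtype Subtype.val_injective LinearMap.id
  let s : E ⧸ N →ₗ[R] E := N.liftQ (LinearMap.id - N.subtype ∘ₗ ρ) fun x hx ↦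
    LinearMap.mem_ker.2 (sub_eq_zero.2 (congrArg Subtype.val (hρ ⟨x, hx⟩).symm))
  have hs (x) : N.mkQ (s x) = x := by
    obtain ⟨x, rfl⟩ := N.mkQ_surjective x
    simp [s]
  refine ⟨fun X Y _ _ _ _ f hf g ↦ ?_⟩
  obtain ⟨h, hh⟩ := Module.Injective.out f hf (s ∘ₗ g)
  exact ⟨N.mkQ ∘ₗ h, fun x ↦ by rw [LinearMap.comp_apply, hh, LinearMap.comp_apply, hs]⟩

open CategoryTheory in
lemma exists_injective_embedding (M : Type u) [AddCommGroup M] [Module R M] :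
    ∃ (E : Type u) (_ : AddCommGroup E) (_ : Module R E) (f : M →ₗ[R] E),
      Module.Injective R E ∧ Function.Injective f :=
  ⟨(Injective.under (ModuleCat.of R M) : ModuleCat.{u} R), inferInstance, inferInstance,
    (Injective.ι (ModuleCat.of R M)).hom,
    (Module.injective_iff_injective_object R _).2
      (inferInstanceAs (Injective (Injective.under (ModuleCat.of R M)))),
    (ModuleCat.mono_iff_injective _).1 inferInstance⟩

lemma IsPowTorsion.exists_injective_embedding [IsNoetherianRing R] {a : Ideal R} {T : Type u}
    [AddCommGroup T] [Module R T] (hT : IsPowTorsion a T) :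
    ∃ (E : Type u) (_ : AddCommGroup E) (_ : Module R E) (f : T →ₗ[R] E),
      Module.Injective R E ∧ Function.Injective f ∧ IsPowTorsion a E := by
  obtain ⟨E, _, _, f, _, hf⟩ := _root_.exists_injective_embedding (R := R) T
  refine ⟨powTorsion a E, inferInstance, inferInstance, f.codRestrict _ fun t ↦ ?_,
    injective_powTorsion a E, fun x y h ↦ hf (congrArg Subtype.val h), isPowTorsion_powTorsion⟩
  obtain ⟨n, hn⟩ := hT t
  exact ⟨n, fun x hx ↦ by rw [← map_smul, hn x hx, map_zero]⟩

end Injective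

section ShortExact

variable {R : Type u} [CommRing R] {A B C : Type u} [AddCommGroup A] [Module R A] [AddCommGroup B]
  [Module R B] [AddCommGroup C] [Module R C] {f : A →ₗ[R] B} {g : B →ₗ[R] C}

lemma shortExact_of_exact (hf : Function.Injective f) (hg : Function.Surjective g)
    (h : Function.Exact f g) :
    (ModuleCat.shortComplexOfCompEqZero f g h.linearMap_comp_eq_zero).ShortExact :=
  ModuleCat.shortComplex_shortExact _ h hf hg

lemma shortExact_subtype_mkQ (N : Submodule R B) :
    (ModuleCat.shortComplexOfCompEqZero N.subtype N.mkQ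
      (LinearMap.exact_subtype_mkQ N).linearMap_comp_eq_zero).ShortExact :=
  shortExact_of_exact N.injective_subtype N.mkQ_surjective (LinearMap.exact_subtype_mkQ N)

lemma shortExact_mkQ_range (hf : Function.Injective f) :
    (ModuleCat.shortComplexOfCompEqZero f (LinearMap.range f).mkQ
      (LinearMap.range_mkQ_comp f)).ShortExact :=
  shortExact_of_exact hf (Submodule.mkQ_surjective _) (LinearMap.exact_map_mkQ_range f)

end ShortExact

section LocalCohomology

open CategoryTheory Limits Opposite Abelian

variable {R : Type u} [CommRing R]

instance : PreservesFilteredColimitsOfSize.{0, 0} (forget (ModuleCat.{u} R)) :=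
  preservesFilteredColimitsOfSize_shrink.{0, u, 0, u} _

instance : HasExactColimitsOfShape ℕᵒᵖᵒᵖ (ModuleCat.{u} R) := by
  have := AB5OfSize_of_univLE.{0, 0, u, u} (ModuleCat.{u} R)
  infer_instance

lemma exact_of_exact_evaluation {J C : Type*} [Category* J] [Category* C] [Abelian C]
    (S : ShortComplex (J ⥤ C)) (h : ∀ j, (S.map ((evaluation J C).obj j)).Exact) : S.Exact := by
  rw [ShortComplex.exact_iff_isZero_homology, Functor.isZero_iff]
  intro j
  exact ((ShortComplex.exact_iff_isZero_homology _).1 (h j)).of_iso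
    (S.mapHomologyIso ((evaluation J C).obj j)).symm

lemma exact_colim_map {F₁ F₂ F₃ : ℕᵒᵖᵒᵖ ⥤ ModuleCat.{u} R} (f : F₁ ⟶ F₂) (g : F₂ ⟶ F₃)
    (h : ∀ n, Function.Exact (f.app n) (g.app n)) :
    Function.Exact (colim.map f) (colim.map g) := by
  have w : f ≫ g = 0 := by
    ext n x
    exact (h n).apply_apply_eq_zero x
  have hS : (ShortComplex.mk f g w).Exact := exact_of_exact_evaluation _ fun j ↦
    (ShortComplex.ShortExact.moduleCat_exact_iff_function_exact _).2 (h j)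
  exact (ShortComplex.ShortExact.moduleCat_exact_iff_function_exact _).1 (hS.map colim)

variable (a : Ideal R)

lemma smul_quotient_eq_zero {x : R} (hx : x ∈ a) (z : R ⧸ a) : x • z = 0 := by
  rw [Algebra.smul_def, Ideal.Quotient.algebraMap_eq, Ideal.Quotient.eq_zero_iff_mem.2 hx, zero_mul]

/-- Evaluation at `1` of the elements of `Ext^0(R/a^n, M) = Hom(R/a^n, M)`. -/
noncomputable def extPowersEval (M : ModuleCat.{u} R) :
    extPowersDiagram a 0 M ⟶ (Functor.const _).obj M where
  app n := ModuleCat.ofHom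
    { toFun e := (Ext.homEquiv₀ e).hom (1 : R ⧸ a ^ n.unop.unop)
      map_add' e e' := by
        change (Ext.addEquiv₀ (e + e')).hom _ = (Ext.addEquiv₀ e).hom _ + (Ext.addEquiv₀ e').hom _
        rw [map_add]
        rfl
      map_smul' r e := by
        change (Ext.linearEquiv₀ (R := R) (r • e)).hom _ = r • (Ext.linearEquiv₀ (R := R) e).hom _
        rw [map_smul]
        rfl }
  naturality n n' f := by
    ext e
    obtain ⟨g, rfl⟩ := Ext.homEquiv₀.symm.surjective e
    let q := (localCohomology.ringModIdeals (localCohomology.idealPowersDiagram a)).map f.unop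
    have h : Ext.homEquiv₀ ((Ext.mk₀ q).comp (Ext.mk₀ g) (zero_add 0)) = q ≫ g := by
      rw [Ext.mk₀_comp_mk₀]
      exact Equiv.apply_symm_apply _ _
    refine congr(($h).hom (1 : R ⧸ a ^ n'.unop.unop)).trans ?_
    exact congr(($(Ext.homEquiv₀.apply_symm_apply g)).hom (1 : R ⧸ a ^ n.unop.unop)).symm

/-- The canonical map from `H^0_a(M)` to `M`. -/
noncomputable def localCohomologyZeroMap (M : ModuleCat.{u} R) :
    colimit (extPowersDiagram a 0 M) ⟶ M :=
  colimit.desc _ ⟨M, extPowersEval a M⟩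

lemma localCohomologyZeroMap_ι (M : ModuleCat.{u} R) (n) (g : _ ⟶ M) :
    localCohomologyZeroMap a M (colimit.ι (extPowersDiagram a 0 M) n (Ext.mk₀ g)) =
      g.hom (1 : R ⧸ a ^ n.unop.unop) := by
  have h := colimit.ι_desc (⟨M, extPowersEval a M⟩ : Cocone (extPowersDiagram a 0 M)) n
  refine congr($h (Ext.mk₀ g)).trans ?_
  exact congr(($(Ext.homEquiv₀.apply_symm_apply g)).hom (1 : R ⧸ a ^ n.unop.unop))

lemma exists_ι_mk₀_eq (M : ModuleCat.{u} R) (z : (colimit (extPowersDiagram a 0 M) : ModuleCat R)) :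
    ∃ (n : ℕᵒᵖᵒᵖ) (g : _ ⟶ M), colimit.ι (extPowersDiagram a 0 M) n (Ext.mk₀ g) = z := by
  obtain ⟨n, e, rfl⟩ := Concrete.colimit_exists_rep _ z
  obtain ⟨g, rfl⟩ := Ext.homEquiv₀.symm.surjective e
  exact ⟨n, g, rfl⟩

lemma localCohomologyZeroMap_injective (M : ModuleCat.{u} R) :
    Function.Injective (localCohomologyZeroMap a M) := by
  rw [injective_iff_map_eq_zero]
  intro z hz
  obtain ⟨n, g, rfl⟩ := exists_ι_mk₀_eq a M z
  have hg_one : g.hom (1 : R ⧸ a ^ n.unop.unop) = 0 :=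
    (localCohomologyZeroMap_ι a M n g).symm.trans hz
  obtain rfl : g = 0 := ModuleCat.hom_ext
    (Submodule.linearMap_qext (a ^ n.unop.unop) (LinearMap.ext_ring hg_one))
  rw [Ext.mk₀_zero]
  exact map_zero _

lemma range_localCohomologyZeroMap (M : ModuleCat.{u} R) :
    LinearMap.range (localCohomologyZeroMap a M).hom = powTorsion a M := by
  ext m
  constructor
  · rintro ⟨z, rfl⟩
    obtain ⟨n, g, rfl⟩ := exists_ι_mk₀_eq a M z
    refine ⟨n.unop.unop, fun x hx ↦
      (congrArg (x • ·) (localCohomologyZeroMap_ι a M n g)).trans ?_⟩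
    exact (map_smul g.hom x (1 : R ⧸ a ^ n.unop.unop)).symm.trans
      ((congrArg g.hom (smul_quotient_eq_zero _ hx 1)).trans (map_zero g.hom))
  · rintro ⟨n, hn⟩
    let g : ModuleCat.of R (R ⧸ a ^ n) ⟶ M :=
      ModuleCat.ofHom ((a ^ n).liftQ (LinearMap.toSpanSingleton R M m) fun x hx ↦ hn x hx)
    exact ⟨colimit.ι (extPowersDiagram a 0 M) (op (op n)) (Ext.mk₀ g),
      (localCohomologyZeroMap_ι a M (op (op n)) g).trans (one_smul R m)⟩

/-- The colimit of the modules `Ext^i(R/a^n, M)`. -/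
noncomputable abbrev extPowersColimit (i : ℕ) (M : ModuleCat.{u} R) : ModuleCat.{u} R :=
  colimit (extPowersDiagram a i M)

/-- Composition with a fixed extension class. -/
noncomputable def extPowersPostcomp {Y Z : ModuleCat.{u} R} {k : ℕ} (β : Ext Y Z k) {i j : ℕ}
    (h : i + k = j) : extPowersDiagram a i Y ⟶ extPowersDiagram a j Z where
  app n := ModuleCat.ofHom (β.postcompOfLinear R _ h)
  naturality n n' f := by
    ext e
    exact Ext.comp_assoc _ _ _ (zero_add i) h (by lia)

variable {S : ShortComplex (ModuleCat.{u} R)}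

lemma extPowersColimit_exact₂ (hS : S.ShortExact) (i : ℕ) :
    Function.Exact (colim.map (extPowersPostcomp a (Ext.mk₀ S.f) (add_zero i)))
      (colim.map (extPowersPostcomp a (Ext.mk₀ S.g) (add_zero i))) :=
  exact_colim_map _ _ fun n ↦ (ShortComplex.ab_exact_iff_function_exact _).1
    (Ext.covariant_sequence_exact₂' (unop ((localCohomology.ringModIdeals
      (localCohomology.idealPowersDiagram a)).op.obj n)) hS i)

lemma extPowersColimit_exact₃ (hS : S.ShortExact) (i : ℕ) :
    Function.Exact (colim.map (extPowersPostcomp a (Ext.mk₀ S.g) (add_zero i)))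
      (colim.map (extPowersPostcomp a hS.extClass (rfl : i + 1 = _))) :=
  exact_colim_map _ _ fun n ↦ (ShortComplex.ab_exact_iff_function_exact _).1
    (Ext.covariant_sequence_exact₃' (unop ((localCohomology.ringModIdeals
      (localCohomology.idealPowersDiagram a)).op.obj n)) hS i _ rfl)

lemma extPowersColimit_exact₁ (hS : S.ShortExact) (i : ℕ) :
    Function.Exact (colim.map (extPowersPostcomp a hS.extClass (rfl : i + 1 = _)))
      (colim.map (extPowersPostcomp a (Ext.mk₀ S.f) (add_zero (i + 1)))) :=
  exact_colim_map _ _ fun n ↦ (ShortComplex.ab_exact_iff_function_exact _).1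
    (Ext.covariant_sequence_exact₁' (unop ((localCohomology.ringModIdeals
      (localCohomology.idealPowersDiagram a)).op.obj n)) hS i _ rfl)

lemma nonempty_extPowersColimit_equiv_succ (hS : S.ShortExact) (i : ℕ)
    (h : Subsingleton (extPowersColimit a i S.X₂))
    (h' : Subsingleton (extPowersColimit a (i + 1) S.X₂)) :
    Nonempty (extPowersColimit a (i + 1) S.X₁ ≃ₗ[R] extPowersColimit a i S.X₃) := by
  refine ⟨(LinearEquiv.ofBijective
    (colim.map (extPowersPostcomp a hS.extClass (rfl : i + 1 = _))).hom ⟨?_, ?_⟩).symm⟩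
  · refine (injective_iff_map_eq_zero _).2 fun x hx ↦ ?_
    obtain ⟨y, rfl⟩ := (extPowersColimit_exact₃ a hS i x).1 hx
    rw [Subsingleton.elim (α := extPowersColimit a i S.X₂) y 0]
    exact map_zero _
  · exact fun x ↦ (extPowersColimit_exact₁ a hS i x).1
      (Subsingleton.elim (α := extPowersColimit a (i + 1) S.X₂) _ _)

lemma nonempty_extPowersColimit_equiv (hS : S.ShortExact) (i : ℕ)
    (h : Subsingleton (extPowersColimit a i S.X₁))
    (h' : Subsingleton (extPowersColimit a (i + 1) S.X₁)) :
    Nonempty (extPowersColimit a i S.X₂ ≃ₗ[R] extPowersColimit a i S.X₃) := by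
  refine ⟨LinearEquiv.ofBijective
    (colim.map (extPowersPostcomp a (Ext.mk₀ S.g) (add_zero i))).hom ⟨?_, ?_⟩⟩
  · refine (injective_iff_map_eq_zero _).2 fun x hx ↦ ?_
    obtain ⟨y, rfl⟩ := (extPowersColimit_exact₂ a hS i x).1 hx
    rw [Subsingleton.elim (α := extPowersColimit a i S.X₁) y 0]
    exact map_zero _
  · exact fun x ↦ (extPowersColimit_exact₃ a hS i x).1
      (Subsingleton.elim (α := extPowersColimit a (i + 1) S.X₁) _ _)

lemma subsingleton_extPowersColimit_succ (hS : S.ShortExact) (i : ℕ)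
    (h : Function.Surjective (colim.map (extPowersPostcomp a (Ext.mk₀ S.g) (add_zero i))))
    (h' : Subsingleton (extPowersColimit a (i + 1) S.X₂)) :
    Subsingleton (extPowersColimit a (i + 1) S.X₁) := by
  refine subsingleton_of_forall_eq 0 fun x ↦ ?_
  obtain ⟨y, rfl⟩ := (extPowersColimit_exact₁ a hS i x).1
    (Subsingleton.elim (α := extPowersColimit a (i + 1) S.X₂) _ _)
  obtain ⟨z, rfl⟩ := h y
  exact (extPowersColimit_exact₃ a hS i).apply_apply_eq_zero z

lemma subsingleton_extPowersColimit_of_injective (i : ℕ) (E : ModuleCat.{u} R) [Injective E] :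
    Subsingleton (extPowersColimit a (i + 1) E) := by
  refine subsingleton_of_forall_eq 0 fun x ↦ ?_
  obtain ⟨n, e, rfl⟩ := Concrete.colimit_exists_rep _ x
  rw [show e = 0 from Ext.eq_zero_of_injective _]
  exact map_zero _

lemma localCohomologyZeroMap_naturality {M N : ModuleCat.{u} R} (g : M ⟶ N) :
    colim.map (extPowersPostcomp a (Ext.mk₀ g) (add_zero 0)) ≫ localCohomologyZeroMap a N =
      localCohomologyZeroMap a M ≫ g := by
  ext z
  obtain ⟨n, f, rfl⟩ := exists_ι_mk₀_eq a M z
  refine Eq.trans ?_ (congrArg g (localCohomologyZeroMap_ι a M n f)).symm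
  have hmap : colim.map (extPowersPostcomp a (Ext.mk₀ g) (add_zero 0))
      (colimit.ι (extPowersDiagram a 0 M) n (Ext.mk₀ f)) =
      colimit.ι (extPowersDiagram a 0 N) n (Ext.mk₀ (f ≫ g)) := by
    rw [← Ext.mk₀_comp_mk₀]
    exact congr($(colimit.ι_map (extPowersPostcomp a (Ext.mk₀ g) (add_zero 0)) n)
      (Ext.mk₀ f))
  exact (congrArg (localCohomologyZeroMap a N) hmap).trans
    (localCohomologyZeroMap_ι a N n (f ≫ g))

lemma colim_map_extPowersPostcomp_surjective {M N : ModuleCat.{u} R} (g : M ⟶ N)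
    (hg : Function.Surjective g) (hM : IsPowTorsion a M) :
    Function.Surjective (colim.map (extPowersPostcomp a (Ext.mk₀ g) (add_zero 0))) := by
  intro y
  obtain ⟨m, hm⟩ := hg (localCohomologyZeroMap a N y)
  obtain ⟨x, hx⟩ : m ∈ LinearMap.range (localCohomologyZeroMap a M).hom := by
    rw [range_localCohomologyZeroMap]
    exact hM m
  refine ⟨x, localCohomologyZeroMap_injective a N ?_⟩
  refine congr($(localCohomologyZeroMap_naturality a g) x).trans ?_
  exact (congrArg g hx).trans hm

lemma nonempty_localCohomologyModule_zero_equiv (M : Type u) [AddCommGroup M] [Module R M] :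
    Nonempty (localCohomologyModule a 0 M ≃ₗ[R] powTorsion a M) :=
  ⟨(localCohomologyIsoColimit a 0 (ModuleCat.of R M)).toLinearEquiv ≪≫ₗ
    (LinearEquiv.ofInjective (localCohomologyZeroMap a (ModuleCat.of R M)).hom
      (localCohomologyZeroMap_injective a (ModuleCat.of R M))) ≪≫ₗ
    LinearEquiv.ofEq _ _ (range_localCohomologyZeroMap a (ModuleCat.of R M))⟩

lemma subsingleton_extPowersColimit_of_isPowTorsion [IsNoetherianRing R] (i : ℕ) (T : Type u)
    [AddCommGroup T] [Module R T] (hT : IsPowTorsion a T) :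
    Subsingleton (extPowersColimit a (i + 1) (ModuleCat.of R T)) := by
  induction i generalizing T with
  | zero =>
    obtain ⟨E, _, _, f, _, hf, hE⟩ := hT.exists_injective_embedding
    have : Injective (ModuleCat.of R E) :=
      (Module.injective_iff_injective_object R _).1 inferInstance
    exact subsingleton_extPowersColimit_succ a (shortExact_mkQ_range hf) 0
      (colim_map_extPowersPostcomp_surjective a _ (Submodule.mkQ_surjective _) hE)
      (subsingleton_extPowersColimit_of_injective a 0 _)
  | succ i ih =>
    obtain ⟨E, _, _, f, _, hf, hE⟩ := hT.exists_injective_embedding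
    have : Injective (ModuleCat.of R E) :=
      (Module.injective_iff_injective_object R _).1 inferInstance
    have := ih _ (hE.quotient (LinearMap.range f))
    exact subsingleton_extPowersColimit_succ a (shortExact_mkQ_range hf) (i + 1)
      (Function.surjective_to_subsingleton (β := extPowersColimit a (i + 1) (ModuleCat.of R
        (E ⧸ LinearMap.range f))) _)
      (subsingleton_extPowersColimit_of_injective a (i + 1) _)

lemma subsingleton_extPowersColimit_of_powTorsion_eq_bot {E : Type u} [AddCommGroup E] [Module R E]
    [Module.Injective R E] (hE : powTorsion a E = ⊥) (i : ℕ) :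
    Subsingleton (extPowersColimit a i (ModuleCat.of R E)) := by
  cases i with
  | zero =>
    refine subsingleton_of_forall_eq 0 fun x ↦ localCohomologyZeroMap_injective a _ ?_
    have hx : localCohomologyZeroMap a _ x ∈ LinearMap.range (localCohomologyZeroMap a _).hom :=
      ⟨x, rfl⟩
    rw [range_localCohomologyZeroMap, hE, Submodule.mem_bot] at hx
    rw [hx, map_zero]
  | succ i =>
    have : Injective (ModuleCat.of R E) :=
      (Module.injective_iff_injective_object R _).1 inferInstance
    exact subsingleton_extPowersColimit_of_injective a i _

lemma exists_torsionFree_injective_embedding [IsNoetherianRing R] (M : Type u) [AddCommGroup M]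
    [Module R M] : ∃ (E : Type u) (_ : AddCommGroup E) (_ : Module R E)
      (f : (M ⧸ powTorsion a M) →ₗ[R] E), Module.Injective R E ∧ Function.Injective f ∧
        powTorsion a E = ⊥ := by
  obtain ⟨E, _, _, f, _, hf⟩ := exists_injective_embedding (R := R) M
  have := injective_powTorsion a E
  have hcomap : powTorsion a M = (powTorsion a E).comap f := by
    ext m
    refine exists_congr fun n ↦ forall₂_congr fun x hx ↦ ?_
    rw [← map_smul, map_eq_zero_iff f hf]
  refine ⟨E ⧸ powTorsion a E, inferInstance, inferInstance,
    (powTorsion a M).mapQ (powTorsion a E) f hcomap.le, injective_quotient E _, ?_,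
    powTorsion_quotient_eq_bot⟩
  rw [← LinearMap.ker_eq_bot, Submodule.ker_mapQ, ← hcomap, Submodule.mkQ_map_self]

lemma nonempty_localCohomologyModule_succ_equiv [IsNoetherianRing R] {M E : Type u}
    [AddCommGroup M] [Module R M] [AddCommGroup E] [Module R E] [Module.Injective R E]
    (hE : powTorsion a E = ⊥) (f : (M ⧸ powTorsion a M) →ₗ[R] E) (hf : Function.Injective f)
    (i : ℕ) : Nonempty (localCohomologyModule a (i + 1) M ≃ₗ[R]
      localCohomologyModule a i (E ⧸ LinearMap.range f)) := by
  have hΓ i := subsingleton_extPowersColimit_of_isPowTorsion a i (powTorsion a M)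
    isPowTorsion_powTorsion
  have hE i := subsingleton_extPowersColimit_of_powTorsion_eq_bot a hE i
  obtain ⟨e₁⟩ := nonempty_extPowersColimit_equiv a (shortExact_subtype_mkQ (powTorsion a M))
    (i + 1) (hΓ i) (hΓ (i + 1))
  obtain ⟨e₂⟩ := nonempty_extPowersColimit_equiv_succ a (shortExact_mkQ_range hf) i (hE i)
    (hE (i + 1))
  exact ⟨(localCohomologyIsoColimit a (i + 1) (ModuleCat.of R M)).toLinearEquiv ≪≫ₗ e₁ ≪≫ₗ e₂ ≪≫ₗ
    (localCohomologyIsoColimit a i (ModuleCat.of R _)).toLinearEquiv.symm⟩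

end LocalCohomology

section ArtinianTorsion

variable {R : Type u} [CommRing R] {T : Type v} [AddCommGroup T] [Module R T]

/-- The elements of the `x`-socle of `T` that are of the form `x ^ k • w` with `w ∈ W`. For an
`x`-torsion module `T` they play the role of leading coefficients: they determine `W` inside any
larger submodule. -/
def leadingSocle (x : R) (W : Submodule R T) (k : ℕ) :
    Submodule R (Submodule.torsionBy R T x) :=
  (W.map (LinearMap.lsmul R T (x ^ k))).comap (Submodule.torsionBy R T x).subtype

lemma leadingSocle_mono (x : R) {W W' : Submodule R T} (h : W ≤ W') {k k' : ℕ} (hk : k ≤ k') :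
    leadingSocle x W k' ≤ leadingSocle x W' k := by
  rintro t ⟨w, hw, hwt⟩
  refine ⟨x ^ (k' - k) • w, h (W.smul_mem _ hw), ?_⟩
  rw [← hwt, LinearMap.lsmul_apply, LinearMap.lsmul_apply, smul_smul, ← pow_add,
    Nat.add_sub_cancel' hk]

lemma le_of_leadingSocle_le {x : R} (hx : ∀ t : T, ∃ n : ℕ, x ^ n • t = 0)
    {W W' : Submodule R T} (hW : W' ≤ W) (h : ∀ k, leadingSocle x W k ≤ leadingSocle x W' k) :
    W ≤ W' := by
  suffices H : ∀ n : ℕ, ∀ w ∈ W, x ^ n • w = 0 → w ∈ W' from fun w hw ↦ by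
    obtain ⟨n, hn⟩ := hx w
    exact H n w hw hn
  intro n
  induction n with
  | zero => exact fun w _ hw0 ↦ by simp_all
  | succ n ih =>
    intro w hw hw0
    have hsocle : x ^ n • w ∈ Submodule.torsionBy R T x := by
      rw [Submodule.mem_torsionBy_iff, smul_smul, ← pow_succ', hw0]
    obtain ⟨w', hw', hww'⟩ := h n (x := ⟨x ^ n • w, hsocle⟩) ⟨w, hw, rfl⟩
    have hsub : w - w' ∈ W' :=
      ih (w - w') (W.sub_mem hw (hW hw')) (by rw [smul_sub, sub_eq_zero]; exact hww'.symm)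
    simpa using W'.add_mem hsub hw'

lemma isArtinian_of_torsionBy {x : R} (hx : ∀ t : T, ∃ n : ℕ, x ^ n • t = 0)
    [IsArtinian R (Submodule.torsionBy R T x)] : IsArtinian R T := by
  refine monotone_stabilizes_iff_artinian.1 fun W ↦ ?_
  have hW {i j} (hij : i ≤ j) : OrderDual.ofDual (W j) ≤ OrderDual.ofDual (W i) := W.monotone hij
  have hstab := (monotone_stabilizes_iff_artinian (R := R)
    (M := Submodule.torsionBy R T x)).2 inferInstance
  -- The diagonal bounds the leading socles of index `≥ N`; the others are finitely many.
  obtain ⟨N, hN⟩ := hstab ⟨fun j ↦ OrderDual.toDual (leadingSocle x (OrderDual.ofDual (W j)) j),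
    fun i j hij ↦ leadingSocle_mono x (hW hij) hij⟩
  choose g hg using fun k ↦ hstab
    ⟨fun j ↦ OrderDual.toDual (leadingSocle x (OrderDual.ofDual (W j)) k),
      fun i j hij ↦ leadingSocle_mono x (hW hij) le_rfl⟩
  refine ⟨N + ∑ k ∈ Finset.range N, g k, fun m hm ↦ le_antisymm (W.monotone hm) ?_⟩
  refine le_of_leadingSocle_le hx (hW hm) fun k ↦ ?_
  rcases lt_or_ge k N with hk | hk
  · have hgk : g k ≤ N + ∑ k ∈ Finset.range N, g k :=
      (Finset.single_le_sum (fun _ _ ↦ Nat.zero_le _) (Finset.mem_range.2 hk)).trans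
        (Nat.le_add_left _ _)
    exact ((hg k _ hgk).symm.trans (hg k _ (hgk.trans hm))).ge
  · calc leadingSocle x (OrderDual.ofDual (W (N + ∑ k ∈ Finset.range N, g k))) k
        ≤ leadingSocle x (OrderDual.ofDual (W N)) N :=
          leadingSocle_mono x (hW (Nat.le_add_right _ _)) hk
      _ = leadingSocle x (OrderDual.ofDual (W (m + k))) (m + k) := hN (m + k) (by lia)
      _ ≤ leadingSocle x (OrderDual.ofDual (W m)) k :=
          leadingSocle_mono x (hW (Nat.le_add_right _ _)) (Nat.le_add_left _ _)

lemma isArtinian_of_torsionBySet (s : Finset R) {T : Type v} [AddCommGroup T] [Module R T]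
    (hs : ∀ x ∈ s, ∀ t : T, ∃ n : ℕ, x ^ n • t = 0)
    [IsArtinian R (Submodule.torsionBySet R T (s : Set R))] : IsArtinian R T := by
  classical
  induction s using Finset.induction_on generalizing T with
  | empty =>
    have htop : Submodule.torsionBySet R T ((∅ : Finset R) : Set R) = ⊤ := by
      ext; simp [Submodule.mem_torsionBySet_iff]
    exact ((LinearEquiv.ofEq _ _ htop).trans Submodule.topEquiv).isArtinian_iff.1 ‹_›
  | insert x s _ ih =>
    let K := Submodule.torsionBy R T x
    have hmem (t : Submodule.torsionBySet R K (s : Set R)) :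
        (t : T) ∈ Submodule.torsionBySet R T (↑(insert x s) : Set R) := by
      rw [Submodule.mem_torsionBySet_iff]
      rintro ⟨y, hy⟩
      rcases Finset.mem_insert.1 hy with rfl | hy
      · exact t.1.2
      · exact congrArg Subtype.val ((Submodule.mem_torsionBySet_iff _ _).1 t.2 ⟨y, hy⟩)
    have : IsArtinian R (Submodule.torsionBySet R K (s : Set R)) :=
      isArtinian_of_injective ((K.subtype ∘ₗ Submodule.subtype _).codRestrict _ hmem)
        ((LinearMap.injective_codRestrict_iff hmem).2
          (K.injective_subtype.comp Subtype.val_injective))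
    have : IsArtinian R K := ih fun y hy t ↦ by
      obtain ⟨n, hn⟩ := hs y (Finset.mem_insert_of_mem hy) t
      exact ⟨n, Subtype.ext hn⟩
    exact isArtinian_of_torsionBy (hs x (Finset.mem_insert_self x s))

lemma IsPowTorsion.isArtinian {a : Ideal R} (hT : IsPowTorsion a T) (ha : a.FG)
    [IsArtinian R (Submodule.torsionBySet R T (a : Set R))] : IsArtinian R T := by
  obtain ⟨s, rfl⟩ := ha
  rw [← Submodule.torsionBySet_eq_torsionBySet_span] at *
  refine isArtinian_of_torsionBySet s fun x hx t ↦ ?_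
  obtain ⟨n, hn⟩ := hT t
  exact ⟨n, hn _ (Ideal.pow_mem_pow (Ideal.subset_span hx) n)⟩

end ArtinianTorsion

section FiniteSocle

variable {R : Type u} [CommRing R] [IsNoetherianRing R] {T : Type v} [AddCommGroup T] [Module R T]

lemma isNoetherian_of_pow_smul_eq_zero {a : Ideal R} {k : ℕ} (h : ∀ x ∈ a ^ k, ∀ t : T, x • t = 0)
    [IsNoetherian R (Submodule.torsionBySet R T (a : Set R))] : IsNoetherian R T := by
  induction k generalizing T with
  | zero =>
    have : Subsingleton T := subsingleton_of_forall_eq 0 fun t ↦ by simpa using h 1 (by simp) t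
    infer_instance
  | succ k ih =>
    let A : Submodule R T := a • ⊤
    have hA : IsNoetherian R A := by
      have hsub (z : Submodule.torsionBySet R A (a : Set R)) :
          (z : T) ∈ Submodule.torsionBySet R T (a : Set R) := by
        rw [Submodule.mem_torsionBySet_iff]
        exact fun x ↦ congrArg Subtype.val ((Submodule.mem_torsionBySet_iff _ _).1 z.2 x)
      have : IsNoetherian R (Submodule.torsionBySet R A (a : Set R)) :=
        isNoetherian_of_injective ((A.subtype ∘ₗ Submodule.subtype _).codRestrict _ hsub)
          ((LinearMap.injective_codRestrict_iff hsub).2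
          (A.injective_subtype.comp Subtype.val_injective))
      have hle : A ≤ Submodule.torsionBySet R T ((a ^ k : Ideal R) : Set R) :=
        Submodule.smul_le.2 fun y hy t _ ↦ by
          rw [Submodule.mem_torsionBySet_iff]
          exact fun x ↦ by rw [smul_smul, h _ (Ideal.mul_mem_mul x.2 hy)]
      exact ih fun x hx z ↦ Subtype.ext ((Submodule.mem_torsionBySet_iff _ _).1 (hle z.2) ⟨x, hx⟩)
    obtain ⟨s, hs⟩ := IsNoetherian.noetherian a
    let g : T →ₗ[R] s → A := LinearMap.pi fun x ↦ (LinearMap.lsmul R T x).codRestrict A fun t ↦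
      Submodule.smul_mem_smul (hs ▸ Submodule.subset_span x.2) trivial
    refine isNoetherian_of_range_eq_ker (Submodule.torsionBySet R T (a : Set R)).subtype g ?_
    ext t
    rw [Submodule.range_subtype, ← hs, ← Submodule.torsionBySet_eq_torsionBySet_span,
      Submodule.mem_torsionBySet_iff, LinearMap.mem_ker, funext_iff]
    exact forall_congr' fun x ↦ (Subtype.ext_iff (a1 := g t x) (a2 := 0)).symm

lemma isArtinian_of_forall_mem_support_isMaximal [Module.Finite R T]
    (h : ∀ p ∈ Module.support R T, p.asIdeal.IsMaximal) : IsArtinian R T := by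
  induction ‹Module.Finite R T› using
    IsNoetherianRing.induction_on_isQuotientEquivQuotientPrime R with
  | subsingleton N => infer_instance
  | quotient N p e =>
    have hp : p ∈ Module.support R N := by
      rw [e.support_eq, Module.support_of_algebra, Ideal.Quotient.algebraMap_eq, Ideal.mk_ker]
      exact le_refl p.asIdeal
    have : IsSimpleModule R (R ⧸ p.asIdeal) := isSimpleModule_iff_isCoatom.2 (h p hp).out
    exact isArtinian_of_injective e.toLinearMap e.injective
  | exact N₁ N₂ N₃ f g hf hg hfg h₁ h₃ =>
    have := h₁ fun p hp ↦ h p (Module.support_subset_of_injective f hf hp)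
    have := h₃ fun p hp ↦ h p (Module.support_subset_of_surjective g hg hp)
    exact isArtinian_of_range_eq_ker f g hfg.linearMap_ker_eq.symm

end FiniteSocle

section Support

variable {R : Type u} [CommRing R] {T : Type v} [AddCommGroup T] [Module R T]

lemma exists_mul_smul_eq_zero_of_fg (p : Ideal R) [p.IsPrime] {b : Ideal R} (hb : b.FG) {t : T}
    (h : ∀ x ∈ b, ∃ u ∈ p.primeCompl, u • x • t = 0) :
    ∃ u ∈ p.primeCompl, ∀ x ∈ b, x • u • t = 0 := by
  induction b, hb using Submodule.fg_induction with
  | singleton x =>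
    obtain ⟨u, hu, hux⟩ := h x (Submodule.mem_span_singleton_self x)
    refine ⟨u, hu, fun y hy ↦ ?_⟩
    obtain ⟨r, rfl⟩ := Submodule.mem_span_singleton.1 hy
    rw [smul_assoc, smul_comm x u, hux, smul_zero]
  | sup b₁ b₂ _ _ h₁ h₂ =>
    obtain ⟨u₁, hu₁, hb₁⟩ := h₁ fun x hx ↦ h x (Submodule.mem_sup_left hx)
    obtain ⟨u₂, hu₂, hb₂⟩ := h₂ fun x hx ↦ h x (Submodule.mem_sup_right hx)
    refine ⟨u₁ * u₂, mul_mem hu₁ hu₂, fun y hy ↦ ?_⟩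
    obtain ⟨y₁, hy₁, y₂, hy₂, rfl⟩ := Submodule.mem_sup.1 hy
    rw [add_smul, mul_smul, smul_comm y₂, hb₂ y₂ hy₂, smul_zero, smul_comm u₁ u₂ t, smul_comm y₁,
      hb₁ y₁ hy₁, smul_zero, add_zero]

lemma isMaximal_of_mem_support [IsArtinian R T] {p : PrimeSpectrum R}
    (hp : p ∈ Module.support R T) : p.asIdeal.IsMaximal := by
  obtain ⟨v, hv⟩ := Module.mem_support_iff_exists_annihilator.1 hp
  let f := LinearMap.toSpanSingleton R T v
  have hker : LinearMap.ker f ≤ p.asIdeal := fun x hx ↦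
    hv ((Submodule.mem_annihilator_span_singleton _ _).2 hx)
  have : IsArtinian R (R ⧸ LinearMap.ker f) :=
    isArtinian_of_injective (f.quotKerEquivRange.toLinearMap) f.quotKerEquivRange.injective
  have : IsArtinian R (R ⧸ p.asIdeal) :=
    isArtinian_of_surjective _ (Submodule.factor hker) (Submodule.factor_surjective hker)
  have : IsArtinianRing (R ⧸ p.asIdeal) := isArtinian_of_tower R this
  exact Ideal.Quotient.maximal_of_isField _ (IsArtinianRing.isField_of_isDomain _)

lemma supportDim_lt_one_of_isArtinian [IsArtinian R T] : Module.supportDim R T < (1 : ℕ) := by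
  by_contra! h
  obtain ⟨s, hs⟩ := Order.le_krullDim_iff.1 h
  have hlt := s.step ⟨0, by lia⟩
  exact (Ideal.isMaximal_def.1 (isMaximal_of_mem_support (s _).2)).2 _ hlt |>
    (isMaximal_of_mem_support (s _).2).ne_top

lemma supportDim_lt_of_forall_minimal_notMem_support {Q : Type*} [AddCommGroup Q] [Module R Q]
    {d : ℕ} (hT : Module.supportDim R T < (d + 1 : ℕ))
    (hQT : Module.support R Q ⊆ Module.support R T)
    (hmin : ∀ p, Minimal (· ∈ Module.support R T) p → p ∉ Module.support R Q) :
    Module.supportDim R Q < (d : ℕ) := by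
  by_contra! h
  obtain ⟨s, hs⟩ := Order.le_krullDim_iff.1 h
  have hhead := hmin _ |>.mt (not_not.2 s.head.2)
  rw [not_minimal_iff_exists_lt (hQT s.head.2)] at hhead
  obtain ⟨q, hq, hqT⟩ := hhead
  exact hT.not_ge (Order.le_krullDim_iff.2
    ⟨(s.map (Set.inclusion hQT) fun _ _ hlt ↦ hlt).cons ⟨q, hqT⟩ hq,
      (RelSeries.cons_length ..).trans (congrArg (· + 1) hs)⟩)

variable {a : Ideal R} [IsNoetherianRing R]

lemma mem_associatedPrimes_of_minimal_mem_support {p : PrimeSpectrum R}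
    (hp : Minimal (· ∈ Module.support R T) p) : p.asIdeal ∈ associatedPrimes R T := by
  obtain ⟨v, hv⟩ := Module.mem_support_iff_exists_annihilator.1 hp.prop
  refine associatedPrimes.subset_of_injective (Submodule.injective_subtype (Submodule.span R {v}))
    (Module.associatedPrimes.minimalPrimes_annihilator_subset_associatedPrimes R _ ?_)
  exact ⟨⟨p.2, hv⟩, fun q ⟨hq, hvq⟩ hqp ↦
    hp.le_of_le (y := ⟨q, hq⟩) (Module.mem_support_iff_exists_annihilator.2 ⟨v, hvq⟩) hqp⟩

lemma IsPowTorsion.associatedPrimes_subset (hT : IsPowTorsion a T) :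
    associatedPrimes R T ⊆ associatedPrimes R (Submodule.torsionBySet R T (a : Set R)) := by
  intro p hp
  obtain ⟨hprime, v, hv⟩ := isAssociatedPrime_iff.1 hp
  have hmem (x) : x ∈ p ↔ x • v = 0 := by
    rw [hv, Submodule.mem_colon_singleton, Submodule.mem_bot]
  obtain ⟨n, hn⟩ := hT v
  have hap : a ≤ p := hprime.le_of_pow_le fun x hx ↦ (hmem x).2 (hn x hx)
  refine isAssociatedPrime_iff.2 ⟨hprime, ⟨v, ?_⟩, ?_⟩
  · rw [Submodule.mem_torsionBySet_iff]
    exact fun x ↦ (hmem x).1 (hap x.2)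
  · ext x
    rw [hmem, Submodule.mem_colon_singleton, Submodule.mem_bot, ← Subtype.coe_inj]
    rfl

lemma IsPowTorsion.finite_associatedPrimes (hT : IsPowTorsion a T)
    [Module.Finite R (Submodule.torsionBySet R T (a : Set R))] :
    (associatedPrimes R T).Finite :=
  (associatedPrimes.finite R _).subset hT.associatedPrimes_subset

lemma IsPowTorsion.finite_minimal_support (hT : IsPowTorsion a T)
    [Module.Finite R (Submodule.torsionBySet R T (a : Set R))] :
    {p | Minimal (· ∈ Module.support R T) p}.Finite := by
  refine Set.Finite.of_finite_image (f := PrimeSpectrum.asIdeal)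
    (hT.finite_associatedPrimes.subset ?_) fun _ _ _ _ h ↦ PrimeSpectrum.ext h
  rintro _ ⟨p, hp, rfl⟩
  exact mem_associatedPrimes_of_minimal_mem_support hp

end Support

section Localization

variable {R : Type u} [CommRing R] {T : Type v} [AddCommGroup T] [Module R T] {a : Ideal R}

lemma IsPowTorsion.localizedModule (hT : IsPowTorsion a T) (S : Submonoid R) :
    IsPowTorsion (a.map (algebraMap R (Localization S))) (LocalizedModule S T) := by
  intro z
  induction z with
  | h t s =>
    obtain ⟨n, hn⟩ := hT t
    have hle : (a ^ n).map (algebraMap R (Localization S)) ≤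
        LinearMap.ker (LinearMap.toSpanSingleton (Localization S) (LocalizedModule S T)
          (LocalizedModule.mk t s)) :=
      Ideal.map_le_iff_le_comap.2 fun x hx ↦ by
        simp [LocalizedModule.smul'_mk, hn x hx]
    exact ⟨n, fun x hx ↦ hle (Ideal.map_pow (algebraMap R (Localization S)) a n ▸ hx)⟩

lemma torsionBySet_localizedModule_le (p : Ideal R) [p.IsPrime] (hb : a.FG) :
    Submodule.torsionBySet (Localization.AtPrime p) (LocalizedModule p.primeCompl T)
        (a.map (algebraMap R (Localization.AtPrime p)) : Set (Localization.AtPrime p)) ≤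
      (Submodule.torsionBySet R T (a : Set R)).localized p.primeCompl := by
  intro z hz
  rw [Submodule.mem_torsionBySet_iff] at hz
  induction z with
  | h t v =>
    have hann (x) (hx : x ∈ a) : ∃ u ∈ p.primeCompl, u • x • t = 0 := by
      have hx0 := hz ⟨_, Ideal.mem_map_of_mem _ hx⟩
      rw [algebraMap_smul, LocalizedModule.smul'_mk, IsLocalizedModule.mk_eq_mk',
        IsLocalizedModule.mk'_eq_zero'] at hx0
      obtain ⟨u, hu⟩ := hx0
      exact ⟨u, u.2, hu⟩
    obtain ⟨u, hu, hut⟩ := exists_mul_smul_eq_zero_of_fg p hb hann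
    refine (Submodule.mem_localized' ..).2 ⟨u • t, ?_, ⟨u, hu⟩ * v, ?_⟩
    · exact (Submodule.mem_torsionBySet_iff _ _).2 fun x ↦ hut x x.2
    · rw [← IsLocalizedModule.mk_eq_mk']
      exact LocalizedModule.mk_cancel_common_left ⟨u, hu⟩ v t

lemma comap_mem_support_of_mem_support_localizedModule {S : Submonoid R}
    {q : PrimeSpectrum (Localization S)}
    (hq : q ∈ Module.support (Localization S) (LocalizedModule S T)) :
    PrimeSpectrum.comap (algebraMap R (Localization S)) q ∈ Module.support R T := by
  have hq' : PrimeSpectrum.comap (algebraMap R (Localization S)) q ∈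
      Module.support R (LocalizedModule S T) :=
    Set.mem_preimage.1 (Module.support_subset_preimage_comap hq)
  obtain ⟨z, hz⟩ := Module.mem_support_iff'.1 hq'
  induction z with
  | h t s =>
    exact Module.mem_support_iff'.2 ⟨t, fun r hr hrt ↦
      hz r hr (by rw [LocalizedModule.smul'_mk, hrt, LocalizedModule.zero_mk])⟩

lemma isMaximal_of_mem_support_localizedModule {p : PrimeSpectrum R}
    (hp : Minimal (· ∈ Module.support R T) p)
    {q : PrimeSpectrum (Localization.AtPrime p.asIdeal)}
    (hq : q ∈ Module.support (Localization.AtPrime p.asIdeal)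
      (LocalizedModule p.asIdeal.primeCompl T)) : q.asIdeal.IsMaximal := by
  have hle : PrimeSpectrum.comap (algebraMap R (Localization.AtPrime p.asIdeal)) q ≤ p := by
    intro y hy
    by_contra hyp
    exact q.2.ne_top (Ideal.eq_top_of_isUnit_mem _ hy
      (IsLocalization.map_units _ (⟨y, hyp⟩ : p.asIdeal.primeCompl)))
  have hcomap : q.asIdeal.comap (algebraMap R _) = p.asIdeal := congrArg PrimeSpectrum.asIdeal
    (hp.eq_of_le (comap_mem_support_of_mem_support_localizedModule hq) hle)
  have hmax : q.asIdeal = IsLocalRing.maximalIdeal (Localization.AtPrime p.asIdeal) := by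
    rw [← Localization.AtPrime.map_eq_maximalIdeal]
    exact (IsLocalization.map_under p.asIdeal.primeCompl _ q.asIdeal).symm.trans
      (congrArg (Ideal.map _) hcomap)
  rw [hmax]
  infer_instance

variable [IsNoetherianRing R]

lemma IsPowTorsion.isArtinian_localizedModule (hT : IsPowTorsion a T)
    [Module.Finite R (Submodule.torsionBySet R T (a : Set R))] {p : PrimeSpectrum R}
    (hp : Minimal (· ∈ Module.support R T) p) :
    IsArtinian (Localization.AtPrime p.asIdeal) (LocalizedModule p.asIdeal.primeCompl T) := by
  let S := Localization.AtPrime p.asIdeal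
  let N := (Submodule.torsionBySet R T (a : Set R)).localized p.asIdeal.primeCompl
  have : IsNoetherianRing S := IsLocalization.isNoetherianRing p.asIdeal.primeCompl S inferInstance
  have : Module.Finite S N := Module.Finite.of_isLocalizedModule p.asIdeal.primeCompl
    (Submodule.toLocalized p.asIdeal.primeCompl (Submodule.torsionBySet R T (a : Set R)))
  have : IsArtinian S N := isArtinian_of_forall_mem_support_isMaximal fun q hq ↦
    isMaximal_of_mem_support_localizedModule hp
      (Module.support_subset_of_injective N.subtype N.injective_subtype hq)
  have hle := torsionBySet_localizedModule_le (T := T) p.asIdeal (IsNoetherian.noetherian a)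
  have := isArtinian_of_injective (Submodule.inclusion hle) (Submodule.inclusion_injective hle)
  exact (hT.localizedModule p.asIdeal.primeCompl).isArtinian (IsNoetherian.noetherian _)

open Filter in
lemma IsPowTorsion.eventually_exists_smul_pow_smul_eq (hT : IsPowTorsion a T)
    [Module.Finite R (Submodule.torsionBySet R T (a : Set R))] {p : PrimeSpectrum R}
    (hp : Minimal (· ∈ Module.support R T) p) (x : R) :
    ∀ᶠ n in atTop, ∀ t : T, ∃ u ∉ p.asIdeal, ∃ t' : T, u • x ^ n • t = x ^ (n + 1) • t' := by
  have := hT.isArtinian_localizedModule hp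
  let f : Module.End (Localization.AtPrime p.asIdeal) (LocalizedModule p.asIdeal.primeCompl T) :=
    algebraMap (Localization.AtPrime p.asIdeal) _ (algebraMap R _ x)
  have hf (n : ℕ) (t : T) (s : p.asIdeal.primeCompl) :
      (f ^ n) (LocalizedModule.mk t s) = LocalizedModule.mk (x ^ n • t) s := by
    rw [← map_pow, ← map_pow, Module.algebraMap_end_apply, algebraMap_smul,
      LocalizedModule.smul'_mk]
  have hstab := f.eventually_iInf_range_pow_eq
  filter_upwards [hstab, (tendsto_add_atTop_nat 1).eventually hstab] with n hn hn' t
  obtain ⟨z, hz⟩ : (f ^ n) (LocalizedModule.mk t 1) ∈ LinearMap.range (f ^ (n + 1)) :=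
    hn' ▸ hn ▸ LinearMap.mem_range_self _ _
  induction z using LocalizedModule.induction_on with
  | h t' s =>
    rw [hf, hf, LocalizedModule.mk_eq] at hz
    obtain ⟨r, hr⟩ := hz
    refine ⟨r * s, mul_mem r.2 s.2, (r : R) • t', ?_⟩
    rw [one_smul] at hr
    rw [mul_smul, smul_comm (x ^ (n + 1))]
    exact hr.symm

open Filter Pointwise in
lemma IsPowTorsion.exists_forall_minimal_notMem_support (hT : IsPowTorsion a T)
    [Module.Finite R (Submodule.torsionBySet R T (a : Set R))] (x : R) :
    ∃ n : ℕ, ∀ p, Minimal (· ∈ Module.support R T) p →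
      p ∉ Module.support R (QuotSMulTop x (x ^ n • ⊤ : Submodule R T)) := by
  have hstab : ∀ᶠ n in atTop, ∀ p ∈ {p | Minimal (· ∈ Module.support R T) p},
      ∀ t : T, ∃ u ∉ p.asIdeal, ∃ t' : T, u • x ^ n • t = x ^ (n + 1) • t' :=
    (eventually_all_finite hT.finite_minimal_support).2 fun p hp ↦
      hT.eventually_exists_smul_pow_smul_eq hp x
  obtain ⟨n, hn⟩ := hstab.exists
  refine ⟨n, fun p hp ↦ Module.notMem_support_iff'.2 fun z ↦ ?_⟩
  obtain ⟨⟨_, t, -, rfl⟩, rfl⟩ := Submodule.mkQ_surjective _ z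
  obtain ⟨u, hu, t', htt'⟩ := hn p hp t
  refine ⟨u, hu, (Submodule.Quotient.mk_eq_zero _).2
    ⟨⟨x ^ n • t', Submodule.smul_mem_pointwise_smul _ _ _ trivial⟩, trivial, Subtype.ext ?_⟩⟩
  exact (smul_smul x (x ^ n) t').trans (by rw [← pow_succ', ← htt']; rfl)

end Localization

section ExtFinite

open CategoryTheory Abelian Pointwise

variable {R : Type u} [CommRing R] (a : Ideal R) (T : Type u) [AddCommGroup T] [Module R T]

/-- The `R`-module `Ext^j(R/a, T)` is finitely generated. -/
def ExtFinite (j : ℕ) : Prop :=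
  Module.Finite R (Ext (ModuleCat.of R (R ⧸ a)) (ModuleCat.of R T) j)

/-- A homomorphism out of `R/a` is determined by the image of `1`, which is an arbitrary element
killed by `a`. -/
def homEquivTorsionBySet : ((R ⧸ a) →ₗ[R] T) ≃ₗ[R] Submodule.torsionBySet R T (a : Set R) where
  toFun g := ⟨g 1, (Submodule.mem_torsionBySet_iff _ _).2 fun x ↦ by
    rw [← map_smul, smul_quotient_eq_zero a x.2, map_zero]⟩
  map_add' _ _ := rfl
  map_smul' _ _ := rfl
  invFun t := a.liftQ (LinearMap.toSpanSingleton R T t) fun x hx ↦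
    (Submodule.mem_torsionBySet_iff _ _).1 t.2 ⟨x, hx⟩
  left_inv g := Submodule.linearMap_qext a (LinearMap.ext_ring (one_smul R (g 1)))
  right_inv t := Subtype.ext (one_smul R (t : T))

/-- The map `Ext^j(R/a, A) → Ext^j(R/a, B)` induced by `f : A → B`. -/
noncomputable abbrev extMap {A B : Type u} [AddCommGroup A] [Module R A] [AddCommGroup B]
    [Module R B] (f : A →ₗ[R] B) (j : ℕ) :
    Ext (ModuleCat.of R (R ⧸ a)) (ModuleCat.of R A) j →ₗ[R]
      Ext (ModuleCat.of R (R ⧸ a)) (ModuleCat.of R B) j :=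
  (Ext.mk₀ (ModuleCat.ofHom f)).postcompOfLinear R _ (add_zero j)

variable {a T}

lemma extFinite_zero_iff : ExtFinite a T 0 ↔ Module.Finite R ((R ⧸ a) →ₗ[R] T) :=
  Module.Finite.equiv_iff (Ext.linearEquiv₀.trans ModuleCat.homLinearEquiv)

lemma ExtFinite.finite_torsionBySet (h : ExtFinite a T 0) :
    Module.Finite R (Submodule.torsionBySet R T (a : Set R)) :=
  (Module.Finite.equiv_iff (homEquivTorsionBySet a T)).1 (extFinite_zero_iff.1 h)

lemma ExtFinite.zero_of_powTorsion_eq_bot (h : powTorsion a T = ⊥) : ExtFinite a T 0 := by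
  have hle : Submodule.torsionBySet R T (a : Set R) ≤ powTorsion a T := fun t ht ↦
    ⟨1, fun x hx ↦ (Submodule.mem_torsionBySet_iff _ _).1 ht ⟨x, by simpa using hx⟩⟩
  rw [extFinite_zero_iff, Module.Finite.equiv_iff (homEquivTorsionBySet a T),
    eq_bot_iff.2 (hle.trans h.le)]
  infer_instance

lemma ExtFinite.succ_of_injective [Module.Injective R T] (j : ℕ) : ExtFinite a T (j + 1) := by
  have : Injective (ModuleCat.of R T) :=
    (Module.injective_iff_injective_object R T).1 inferInstance
  have := Ext.subsingleton_of_injective (ModuleCat.of R (R ⧸ a)) (ModuleCat.of R T) j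
  exact Module.Finite.of_finite

lemma smul_ext_eq_zero {x : R} (hx : x ∈ a) {Y : ModuleCat.{u} R} {j : ℕ}
    (e : Ext (ModuleCat.of R (R ⧸ a)) Y j) : x • e = 0 := by
  have h : x • 𝟙 (ModuleCat.of R (R ⧸ a)) = 0 :=
    ModuleCat.hom_ext (LinearMap.ext (smul_quotient_eq_zero a hx))
  rw [← Ext.mk₀_id_comp e, ← Ext.smul_comp, ← Ext.mk₀_smul, h, Ext.mk₀_zero, Ext.zero_comp]

/-- Multiplication by `y`, as a map onto the submodule `yT`. -/
def smulToSMulTop (y : R) (T : Type*) [AddCommGroup T] [Module R T] :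
    T →ₗ[R] (y • ⊤ : Submodule R T) :=
  (LinearMap.lsmul R T y).codRestrict _ fun _ ↦ Submodule.smul_mem_pointwise_smul _ _ _ trivial

lemma smulToSMulTop_surjective (y : R) : Function.Surjective (smulToSMulTop y T) := by
  rintro ⟨_, t, -, rfl⟩
  exact ⟨t, rfl⟩

lemma exact_torsionBy_subtype_smulToSMulTop (y : R) :
    Function.Exact (Submodule.torsionBy R T y).subtype (smulToSMulTop y T) := fun t ↦
  ⟨fun h ↦ ⟨⟨t, congrArg Subtype.val h⟩, rfl⟩, by rintro ⟨t, rfl⟩; exact Subtype.ext t.2⟩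

lemma finite_ker_extMap_subtype {j : ℕ} (N : Submodule R T)
    (h : ∀ i, i + 1 = j → ExtFinite a (T ⧸ N) i) :
    Module.Finite R (LinearMap.ker (extMap a N.subtype j)) := by
  cases j with
  | zero =>
    have : Mono (ModuleCat.ofHom N.subtype) :=
      (ModuleCat.mono_iff_injective _).2 N.injective_subtype
    rw [LinearMap.ker_eq_bot.2 (Ext.postcomp_mk₀_injective_of_mono _ (ModuleCat.ofHom N.subtype))]
    infer_instance
  | succ j =>
    have hS := shortExact_subtype_mkQ N
    have hex : Function.Exact (hS.extClass.postcompOfLinear R (ModuleCat.of R (R ⧸ a)) rfl)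
        (extMap a N.subtype (j + 1)) :=
      (ShortComplex.ab_exact_iff_function_exact _).1
        (Ext.covariant_sequence_exact₁' _ hS j (j + 1) rfl)
    rw [hex.linearMap_ker_eq]
    have : Module.Finite R _ := h j rfl
    infer_instance

variable [IsNoetherianRing R]

lemma finite_of_exact {X Y Z : Type*} [AddCommGroup X] [Module R X] [AddCommGroup Y] [Module R Y]
    [AddCommGroup Z] [Module R Z] {f : X →ₗ[R] Y} {g : Y →ₗ[R] Z} (h : Function.Exact f g)
    (_ : Module.Finite R X) (_ : Module.Finite R Z) : Module.Finite R Y := by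
  have := isNoetherian_of_range_eq_ker f g h.linearMap_ker_eq.symm
  infer_instance

lemma ExtFinite.of_finite [Module.Finite R T] (j : ℕ) : ExtFinite a T j :=
  ModuleCat.finite_ext R (ModuleCat.of R (R ⧸ a)) (ModuleCat.of R T) j

variable {A B C : Type u} [AddCommGroup A] [Module R A] [AddCommGroup B] [Module R B]
  [AddCommGroup C] [Module R C] {f : A →ₗ[R] B} {g : B →ₗ[R] C} {j : ℕ}

lemma ExtFinite.middle (hf : Function.Injective f) (hg : Function.Surjective g)
    (h : Function.Exact f g) (hA : ExtFinite a A j) (hC : ExtFinite a C j) : ExtFinite a B j :=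
  finite_of_exact (f := extMap a f j) (g := extMap a g j)
    ((ShortComplex.ab_exact_iff_function_exact _).1
      (Ext.covariant_sequence_exact₂' _ (shortExact_of_exact hf hg h) j)) hA hC

lemma ExtFinite.right (hf : Function.Injective f) (hg : Function.Surjective g)
    (h : Function.Exact f g) (hB : ExtFinite a B j) (hA : ExtFinite a A (j + 1)) :
    ExtFinite a C j := by
  have hS := shortExact_of_exact hf hg h
  exact finite_of_exact (f := extMap a g j) (g := hS.extClass.postcompOfLinear R _ rfl)
    ((ShortComplex.ab_exact_iff_function_exact _).1
      (Ext.covariant_sequence_exact₃' _ hS j (j + 1) rfl)) hB hA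

lemma ExtFinite.left (hf : Function.Injective f) (hg : Function.Surjective g)
    (h : Function.Exact f g) (hC : ExtFinite a C j) (hB : ExtFinite a B (j + 1)) :
    ExtFinite a A (j + 1) := by
  have hS := shortExact_of_exact hf hg h
  exact finite_of_exact (f := hS.extClass.postcompOfLinear R _ rfl) (g := extMap a f (j + 1))
    ((ShortComplex.ab_exact_iff_function_exact _).1
      (Ext.covariant_sequence_exact₁' _ hS j (j + 1) rfl)) hC hB

lemma ExtFinite.of_injective (hf : Function.Injective f) (hB : ExtFinite a B 0) :
    ExtFinite a A 0 := by
  have : Mono (ModuleCat.ofHom f) := (ModuleCat.mono_iff_injective _).2 hf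
  have : Module.Finite R _ := hB
  exact Module.Finite.of_injective (extMap a f 0)
    (Ext.postcomp_mk₀_injective_of_mono _ (ModuleCat.ofHom f))

lemma ExtFinite.of_equiv (e : A ≃ₗ[R] B) (hA : ExtFinite a A j) : ExtFinite a B j :=
  .middle (C := PUnit.{u + 1}) (f := e.toLinearMap) (g := 0) e.injective
    (fun _ ↦ ⟨0, Subsingleton.elim _ _⟩)
    ((e.toLinearMap.exact_zero_iff_surjective _).2 e.surjective) hA (.of_finite j)

lemma ExtFinite.quotient (hT : ExtFinite a T j) (L : Submodule R T) (hL : ExtFinite a L (j + 1)) :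
    ExtFinite a (T ⧸ L) j :=
  .right L.injective_subtype L.mkQ_surjective (LinearMap.exact_subtype_mkQ L) hT hL

lemma ExtFinite.of_submodule_of_quotient (L : Submodule R T) (hL : ExtFinite a L j)
    (hT : ExtFinite a (T ⧸ L) j) : ExtFinite a T j :=
  .middle L.injective_subtype L.mkQ_surjective (LinearMap.exact_subtype_mkQ L) hL hT

lemma ExtFinite.powTorsion (h : ∀ j < 2, ExtFinite a T j) : ∀ j < 2, ExtFinite a (powTorsion a T) j
  | 0, hj => .of_injective (Submodule.injective_subtype _) (h 0 hj)
  | 1, hj => .left (Submodule.injective_subtype _) (Submodule.mkQ_surjective _)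
      (LinearMap.exact_subtype_mkQ _) (.zero_of_powTorsion_eq_bot powTorsion_quotient_eq_bot)
      (h 1 hj)

/- Since `x` kills `Ext^j(R/a, T)`, the map from `Ext^j(R/a, T)` to `Ext^j(R/a, xT)` induced by
multiplication by `x` has its image in the kernel of the map induced by the inclusion of `xT`. -/
lemma ExtFinite.of_torsionBy_of_quotSMulTop {x : R} (hx : x ∈ a)
    (h₁ : ExtFinite a (Submodule.torsionBy R T x) j)
    (h₂ : ∀ i, i + 1 = j → ExtFinite a (QuotSMulTop x T) i) : ExtFinite a T j := by
  let α := extMap a (smulToSMulTop x T) j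
  let β := extMap a (x • ⊤ : Submodule R T).subtype j
  have hβα (e) : β (α e) = 0 := by
    have hcomp : ModuleCat.ofHom (smulToSMulTop x T) ≫
        ModuleCat.ofHom (x • ⊤ : Submodule R T).subtype = x • 𝟙 (ModuleCat.of R T) := rfl
    refine (Ext.comp_assoc_of_third_deg_zero e _ _ (add_zero j)).trans ?_
    rw [Ext.mk₀_comp_mk₀, hcomp, ← Ext.smul_eq_comp_mk₀]
    exact smul_ext_eq_zero hx e
  have hex : Function.Exact (extMap a (Submodule.torsionBy R T x).subtype j) α :=
    (ShortComplex.ab_exact_iff_function_exact _).1 (Ext.covariant_sequence_exact₂' _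
      (shortExact_of_exact (Submodule.injective_subtype _) (smulToSMulTop_surjective x)
        (exact_torsionBy_subtype_smulToSMulTop x)) j)
  refine finite_of_exact (f := extMap a (Submodule.torsionBy R T x).subtype j)
    (g := α.codRestrict (LinearMap.ker β) hβα) ?_ h₁ (finite_ker_extMap_subtype _ h₂)
  exact fun e ↦ Subtype.ext_iff.trans (hex e)

end ExtFinite

section InDimension

variable {R : Type u} [CommRing R] {T T' : Type v} [AddCommGroup T] [Module R T] [AddCommGroup T']
  [Module R T'] {n : ℕ}

lemma annihilator_lt_annihilator_torsionBy {N : Type*} [AddCommGroup N] [Module R N]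
    (f : N →ₗ[R] T) (hf : Function.Injective f) {y : R} (hy : y ∉ Module.annihilator R T) :
    Module.annihilator R T < Module.annihilator R (Submodule.torsionBy R N y) := by
  refine SetLike.lt_iff_le_and_exists.2 ⟨?_, y, ?_, hy⟩
  · exact (f ∘ₗ (Submodule.torsionBy R N y).subtype).annihilator_le_of_injective
      (hf.comp (Submodule.injective_subtype _))
  · exact Module.mem_annihilator.2 fun t ↦ Subtype.ext t.2

lemma isInDimensionLT_of_equiv (e : T ≃ₗ[R] T') (h : Module.IsInDimensionLT R T n) :
    Module.IsInDimensionLT R T' n := by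
  obtain ⟨L, hL, hdim⟩ := h
  refine ⟨L.map e.toLinearMap, hL.map _, ?_⟩
  rwa [← Module.supportDim_eq_of_equiv (Submodule.Quotient.equiv L _ e rfl)]

lemma isInDimensionLT_smul_top_of_equiv (e : T ≃ₗ[R] T') (b : Ideal R)
    (h : Module.IsInDimensionLT R (b • ⊤ : Submodule R T) n) :
    Module.IsInDimensionLT R (b • ⊤ : Submodule R T') n := by
  have hmap : (b • ⊤ : Submodule R T).map e.toLinearMap = b • ⊤ := by
    rw [Submodule.map_smul'', Submodule.map_top, LinearEquiv.range]
  exact hmap ▸ isInDimensionLT_of_equiv (e.submoduleMap _) h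

lemma isInDimensionLT_of_quotient {L : Submodule R T} (hL : L.FG)
    (h : Module.IsInDimensionLT R (T ⧸ L) n) : Module.IsInDimensionLT R T n := by
  obtain ⟨V, hV, hdim⟩ := h
  have hmap : (V.comap L.mkQ).map L.mkQ = V :=
    Submodule.map_comap_eq_of_surjective L.mkQ_surjective V
  have hle : L ≤ V.comap L.mkQ := L.le_comap_mkQ V
  refine ⟨V.comap L.mkQ, Submodule.fg_of_fg_map_of_fg_inf_ker L.mkQ (hmap.symm ▸ hV) ?_, ?_⟩
  · rwa [Submodule.ker_mkQ, inf_eq_right.2 hle]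
  · rwa [← Module.supportDim_eq_of_equiv
      (Submodule.quotientQuotientEquivQuotient L (V.comap L.mkQ) hle), hmap]

lemma isInDimensionLT_one_of_isMinimax (h : Module.IsMinimax R T) : Module.IsInDimensionLT R T 1 :=
  let ⟨L, hL, _⟩ := h
  ⟨L, hL, supportDim_lt_one_of_isArtinian⟩

end InDimension

section Cofinite

open Pointwise

variable {R : Type u} [CommRing R] [IsNoetherianRing R] {a : Ideal R} {T : Type u} [AddCommGroup T]
  [Module R T]

lemma ExtFinite.smul_top {y : R} {j : ℕ} (h : ExtFinite a T j)
    (hy : ExtFinite a (Submodule.torsionBy R T y) (j + 1)) :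
    ExtFinite a (y • ⊤ : Submodule R T) j :=
  .right (Submodule.injective_subtype _) (smulToSMulTop_surjective y)
    (exact_torsionBy_subtype_smulToSMulTop y) h hy

lemma ExtFinite.of_torsionBy_of_smul_top {y : R} {j : ℕ}
    (hK : ExtFinite a (Submodule.torsionBy R T y) j)
    (hD : ExtFinite a (y • ⊤ : Submodule R T) j) : ExtFinite a T j :=
  .middle (Submodule.injective_subtype _) (smulToSMulTop_surjective y)
    (exact_torsionBy_subtype_smulToSMulTop y) hK hD

/- In degree `1` the four-term exact sequence `0 → (0 :_T y) → T → yT → 0` only needs `Ext^0` of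
`yT`, which is controlled by `Ext^0` of `T`; nothing of the kind holds in degree `2`. -/
lemma ExtFinite.torsionBy {d : ℕ} (hd : d ≤ 2) (h : ∀ j < d, ExtFinite a T j) (y : R) :
    ∀ j < d, ExtFinite a (Submodule.torsionBy R T y) j
  | 0, hj => .of_injective (Submodule.injective_subtype _) (h 0 hj)
  | 1, hj => .left (Submodule.injective_subtype _) (smulToSMulTop_surjective y)
      (exact_torsionBy_subtype_smulToSMulTop y)
      (.of_injective (Submodule.injective_subtype _) (h 0 (by lia))) (h 1 hj)
  | j + 2, hj => absurd hj (by lia)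

lemma ExtFinite.of_le_radical_annihilator (ha : a ≤ (Module.annihilator R T).radical)
    (h : ExtFinite a T 0) (j : ℕ) : ExtFinite a T j := by
  obtain ⟨k, hk⟩ := Ideal.exists_pow_le_of_le_radical_of_fg ha (IsNoetherian.noetherian a)
  have := h.finite_torsionBySet
  have := isNoetherian_of_pow_smul_eq_zero fun x hx ↦ Module.mem_annihilator.1 (hk hx)
  exact .of_finite j

theorem ExtFinite.of_supportDim_lt {d : ℕ} (hd : d ≤ 2) (hT : IsPowTorsion a T)
    (hdim : Module.supportDim R T < (d : ℕ)) (h : ∀ j < d, ExtFinite a T j) (j : ℕ) :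
    ExtFinite a T j := by
  induction d generalizing T j with
  | zero =>
    have : Subsingleton T := not_nontrivial_iff_subsingleton.1 fun _ ↦ hdim.not_ge
      (Order.krullDim_nonneg_iff.2 (Module.nonempty_support_of_nontrivial).to_subtype)
    exact .of_finite j
  | succ d ihd =>
  induction hJ : Module.annihilator R T using WellFoundedGT.induction generalizing T j with
  | ind J ihJ =>
  subst hJ
  by_cases ha : a ≤ (Module.annihilator R T).radical
  · exact .of_le_radical_annihilator ha (h 0 d.succ_pos) j
  obtain ⟨x, hxa, hx⟩ := SetLike.not_le_iff_exists.1 ha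
  have := (h 0 d.succ_pos).finite_torsionBySet
  obtain ⟨n, hn⟩ := hT.exists_forall_minimal_notMem_support x
  have htorsionBy {N : Type u} [AddCommGroup N] [Module R N] (f : N →ₗ[R] T)
      (hf : Function.Injective f) (hN : ∀ j < d + 1, ExtFinite a N j) {y : R}
      (hy : y ∉ Module.annihilator R T) (j : ℕ) : ExtFinite a (Submodule.torsionBy R N y) j :=
    ihJ _ (annihilator_lt_annihilator_torsionBy f hf hy) ((hT.of_injective f hf).submodule _)
      ((Module.supportDim_le_of_injective (f ∘ₗ Submodule.subtype _)
        (hf.comp (Submodule.injective_subtype _))).trans_lt hdim)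
      (ExtFinite.torsionBy hd hN y) j rfl
  have hK : ∀ j, ExtFinite a (Submodule.torsionBy R T (x ^ n)) j :=
    htorsionBy LinearMap.id Function.injective_id h fun hxn ↦ hx ⟨n, hxn⟩
  let D : Submodule R T := x ^ n • ⊤
  have hD : ∀ j < d + 1, ExtFinite a D j := fun j hj ↦ (h j hj).smul_top (hK (j + 1))
  have hDK : ∀ j, ExtFinite a (Submodule.torsionBy R D x) j :=
    htorsionBy D.subtype D.injective_subtype hD fun hxT ↦ hx (Ideal.le_radical hxT)
  have hsupp : Module.support R (QuotSMulTop x D) ⊆ Module.support R T :=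
    (Module.support_subset_of_surjective _ (Submodule.mkQ_surjective _)).trans
      (Module.support_subset_of_injective D.subtype D.injective_subtype)
  have hQ : ∀ j, ExtFinite a (QuotSMulTop x D) j :=
    ihd (by lia) ((hT.submodule D).quotient _)
      (supportDim_lt_of_forall_minimal_notMem_support hdim hsupp hn) fun j hj ↦
        (hD j (by lia)).quotient _ ((hD (j + 1) (by lia)).smul_top (hDK (j + 2)))
  exact .of_torsionBy_of_smul_top (hK j) (.of_torsionBy_of_quotSMulTop hxa (hDK j) fun i _ ↦ hQ i)

lemma ExtFinite.finite_torsionBySet_pow (h : ExtFinite a T 0) (t : ℕ) :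
    Module.Finite R (Submodule.torsionBySet R T ((a ^ t : Ideal R) : Set R)) := by
  let Z := Submodule.torsionBySet R T ((a ^ t : Ideal R) : Set R)
  have hZ : ExtFinite a Z 0 := .of_injective Z.injective_subtype h
  have := hZ.finite_torsionBySet
  have : IsNoetherian R Z := isNoetherian_of_pow_smul_eq_zero (a := a) (k := t) fun x hx z ↦
    Subtype.ext ((Submodule.mem_torsionBySet_iff _ _).1 z.2 ⟨x, hx⟩)
  exact Module.IsNoetherian.finite R Z

lemma support_quotient_torsionBySet_subset (b : Ideal R) (L : Submodule R (b • ⊤ : Submodule R T)) :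
    Module.support R ((T ⧸ L.map (Submodule.subtype _)) ⧸
        Submodule.torsionBySet R (T ⧸ L.map (Submodule.subtype _)) (b : Set R)) ⊆
      Module.support R ((b • ⊤ : Submodule R T) ⧸ L) := by
  intro p hp
  contrapose! hp
  rw [Module.notMem_support_iff'] at hp ⊢
  intro z
  obtain ⟨z, rfl⟩ := Submodule.mkQ_surjective _ z
  obtain ⟨t, rfl⟩ := Submodule.mkQ_surjective _ z
  obtain ⟨u, hu, h⟩ := exists_mul_smul_eq_zero_of_fg p.asIdeal (IsNoetherian.noetherian b)
    (t := (L.map (Submodule.subtype _)).mkQ t) fun x hx ↦ by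
      obtain ⟨r, hr, hrx⟩ := hp (L.mkQ ⟨x • t, Submodule.smul_mem_smul hx trivial⟩)
      refine ⟨r, hr, ?_⟩
      rw [← map_smul, Submodule.mkQ_apply, Submodule.Quotient.mk_eq_zero] at hrx
      rw [← map_smul, ← map_smul, Submodule.mkQ_apply, Submodule.Quotient.mk_eq_zero]
      exact ⟨_, hrx, rfl⟩
  refine ⟨u, hu, ?_⟩
  rw [← map_smul, Submodule.mkQ_apply, Submodule.Quotient.mk_eq_zero,
    Submodule.mem_torsionBySet_iff]
  exact fun x ↦ h x x.2

theorem ExtFinite.isInDimensionLT_of_pow_smul_top (h : ExtFinite a T 0) {t n : ℕ}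
    (hdim : Module.IsInDimensionLT R (a ^ t • ⊤ : Submodule R T) n) :
    Module.IsInDimensionLT R T n := by
  obtain ⟨L, hL, hdim⟩ := hdim
  let L₁ : Submodule R T := L.map (Submodule.subtype _)
  have hL₁ : L₁.FG := hL.map _
  have := Module.Finite.iff_fg.2 hL₁
  have hV := (h.quotient L₁ (.of_finite 1)).finite_torsionBySet_pow t
  refine isInDimensionLT_of_quotient hL₁ ⟨_, Module.Finite.iff_fg.1 hV, lt_of_le_of_lt ?_ hdim⟩
  exact Order.krullDim_le_of_strictMono
    (Set.inclusion (support_quotient_torsionBySet_subset (a ^ t) L)) fun _ _ h ↦ h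

theorem ExtFinite.of_isInDimensionLT {d : ℕ} (hd : d ≤ 2) (hT : IsPowTorsion a T)
    (hdim : Module.IsInDimensionLT R T d) (h : ∀ j < d, ExtFinite a T j) (j : ℕ) :
    ExtFinite a T j := by
  obtain ⟨L, hL, hdim⟩ := hdim
  have := Module.Finite.iff_fg.2 hL
  exact .of_submodule_of_quotient L (.of_finite j) (.of_supportDim_lt hd (hT.quotient L) hdim
    (fun i hi ↦ (h i hi).quotient L (.of_finite (i + 1))) j)

end Cofinite

section Cofiniteness

variable {R : Type u} [CommRing R] [IsNoetherianRing R] {a : Ideal R}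

lemma exists_extFinite_localCohomologyModule_shift {M : Type u} [AddCommGroup M] [Module R M]
    (hG : ∀ j, ExtFinite a (powTorsion a M) j) {n : ℕ} (hM : ∀ j ≤ n + 1, ExtFinite a M j) :
    ∃ (C : Type u) (_ : AddCommGroup C) (_ : Module R C), (∀ j ≤ n, ExtFinite a C j) ∧
      ∀ i, Nonempty (localCohomologyModule a (i + 1) M ≃ₗ[R] localCohomologyModule a i C) := by
  obtain ⟨E, _, _, f, _, hf, hE⟩ := exists_torsionFree_injective_embedding a M
  have hEj : ∀ j, ExtFinite a E j
    | 0 => .zero_of_powTorsion_eq_bot hE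
    | j + 1 => .succ_of_injective j
  have hQ : ∀ j ≤ n + 1, ExtFinite a (M ⧸ powTorsion a M) j := fun j hj ↦
    (hM j hj).quotient _ (hG (j + 1))
  exact ⟨E ⧸ LinearMap.range f, inferInstance, inferInstance,
    fun j hj ↦ .right hf (Submodule.mkQ_surjective _) (LinearMap.exact_map_mkQ_range f) (hEj j)
      (hQ (j + 1) (by lia)),
    nonempty_localCohomologyModule_succ_equiv a hE f hf⟩

theorem extFinite_localCohomologyModule {r : ℕ} {M : Type u} [AddCommGroup M] [Module R M]
    (hM : ∀ j ≤ r + 1, ExtFinite a M j)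
    (h : ∀ i < r, ∃ t : ℕ, Module.IsInDimensionLT R
      (a ^ t • ⊤ : Submodule R (localCohomologyModule a i M)) 2) :
    IsPowTorsion a (localCohomologyModule a r M) ∧
      ∀ j < 2, ExtFinite a (localCohomologyModule a r M) j := by
  induction r generalizing M with
  | zero =>
    obtain ⟨e⟩ := nonempty_localCohomologyModule_zero_equiv a M
    refine ⟨isPowTorsion_powTorsion.of_injective e.toLinearMap e.injective, fun j hj ↦ ?_⟩
    exact (ExtFinite.powTorsion (fun i hi ↦ hM i (by lia)) j hj).of_equiv e.symm
  | succ r ih =>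
    obtain ⟨e₀⟩ := nonempty_localCohomologyModule_zero_equiv a M
    obtain ⟨t, ht⟩ := h 0 r.succ_pos
    have hG₂ : ∀ j < 2, ExtFinite a (powTorsion a M) j :=
      ExtFinite.powTorsion fun i hi ↦ hM i (by lia)
    have hG : ∀ j, ExtFinite a (powTorsion a M) j :=
      .of_isInDimensionLT le_rfl isPowTorsion_powTorsion
        ((hG₂ 0 two_pos).isInDimensionLT_of_pow_smul_top
          (isInDimensionLT_smul_top_of_equiv e₀ _ ht)) hG₂
    obtain ⟨C, _, _, hC, hshift⟩ := exists_extFinite_localCohomologyModule_shift hG hM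
    obtain ⟨hT, hext⟩ := ih hC fun i hi ↦
      let ⟨t, ht⟩ := h (i + 1) (Nat.succ_lt_succ hi)
      ⟨t, isInDimensionLT_smul_top_of_equiv (hshift i).some _ ht⟩
    obtain ⟨e⟩ := hshift r
    exact ⟨hT.of_injective e.toLinearMap e.injective, fun j hj ↦ (hext j hj).of_equiv e.symm⟩

theorem theorem3p6_general (M : Type u) [AddCommGroup M] [Module R M] (r : ℕ)
    (hM : ∀ j ≤ r + 1, ExtFinite a M j)
    (h : ∀ i < r, ∃ t : ℕ, Module.IsInDimensionLT R
      (a ^ t • ⊤ : Submodule R (localCohomologyModule a i M)) 2)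
    (N : Submodule R (localCohomologyModule a r M)) (hN : Module.IsInDimensionLT R N 1) :
    Module.Finite R ((R ⧸ a) →ₗ[R] (localCohomologyModule a r M ⧸ N)) ∧
      (associatedPrimes R (localCohomologyModule a r M ⧸ N)).Finite := by
  obtain ⟨hT, hext⟩ := extFinite_localCohomologyModule hM h
  have hN₀ : ExtFinite a N 0 := .of_injective N.injective_subtype (hext 0 two_pos)
  have hN₁ : ExtFinite a N 1 := .of_isInDimensionLT one_le_two (hT.submodule N) hN
    (fun j hj ↦ Nat.lt_one_iff.1 hj ▸ hN₀) 1
  have hQ : ExtFinite a (localCohomologyModule a r M ⧸ N) 0 := (hext 0 two_pos).quotient N hN₁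
  have := hQ.finite_torsionBySet
  exact ⟨extFinite_zero_iff.1 hQ, (hT.quotient N).finite_associatedPrimes⟩

end Cofiniteness

theorem theorem3p6 {R : Type u} [CommRing R] [IsNoetherianRing R] (a : Ideal R)
    (M : Type u) [AddCommGroup M] [Module R M] [Module.Finite R M] (r : ℕ)
    (h : ∃ t : ℕ, ∀ i < r, Module.IsInDimensionLT R
      (a ^ t • ⊤ : Submodule R (localCohomologyModule a i M)) 2)
    (N : Submodule R (localCohomologyModule a r M)) (hN : Module.IsMinimax R N) :
    Module.Finite R ((R ⧸ a) →ₗ[R] (localCohomologyModule a r M ⧸ N)) ∧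
      (associatedPrimes R (localCohomologyModule a r M ⧸ N)).Finite := by
  obtain ⟨t, h⟩ := h
  exact theorem3p6_general M r (fun j _ ↦ .of_finite j) (fun i hi ↦ ⟨t, h i hi⟩) N
    (isInDimensionLT_one_of_isMinimax hN)
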